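/- **Setting.** There are $K$ arms and $N$ players, $1\le N<K$. The rewards of arm $i$ are i.i.d. over rounds, with a distribution $\nu_i$ on $[0,1]$ and mean $\mu_i$, independently over arms. In every round each player chooses an arm; a player has a *collision* in that round if another player chooses the same arm, and then she gets no reward. Let $\mu_{(1)}\ge\dots\ge\mu_{(K)}$ be the ordered means. If player $j$ plays arm $a_j(t)$ in round $t$ and $\eta_j(t)\in\{0,1\}$ is her collision indicator, the regret after $T$ rounds is $$R_T=\sum_{t=1}^{T}\sum_{k=1}^{N}\mu_{(k)}-\sum_{t=1}^{T}\sum_{j=1}^{N}\mu_{a_j(t)}\,(1-\eta_j(t)).$$ **Algorithm (Musical Chairs, parameter $T_0$), run by every player with her own independent randomness.** In each of the first $T_0$ rounds the player picks an arm uniformly among all $K$ arms; she counts her collisions $C$ and, for every arm, averages the rewards she received from it in rounds without collision (the average is $0$ if there was no such round). She then sorts the arms into a list $A$ by non-increasing empirical mean (ties broken by any fixed measurable rule) and sets $$N^*=\mathrm{round}\left(\frac{\log\frac{T_0-C}{T_0}}{\log(1-\frac1K)}+1\right),\qquad N^*=K\ \text{ if } C=T_0 .$$ From then on she picks in every round a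 uniformly random arm among the first $\min(N^*,K)$ arms of $A$ until she picks one without collision; she plays that arm in all later rounds. Her list is an *$\varepsilon$-correct ranking* if arm $i$ is listed before arm $i'$ whenever $\mu_i-\mu_{i'}>\varepsilon$. **Theorem.** Let $\Delta=\mu_{(N)}-\mu_{(N+1)}>0$, $0<\varepsilon<\Delta$, $\delta\in(0,1)$, and let $\delta_2>0$ with $N\delta_2\le\delta$ ($\delta_2$ is the failure probability allowed for each single player's estimate of $N$; for example $\delta_2=\delta/K$). Let all $N$ players run the algorithm with $$T_0=\left\lceil\max\left(\frac K2\ln\frac{2K^2}{\delta},\ \frac{16K}{\varepsilon^2}\ln\frac{4K^2}{\delta},\ \frac{K^2\ln(2/\delta_2)}{0.02}\right)\right\rceil .$$ Let $E$ be the event that every player's list is an $\varepsilon$-correct ranking and that $N^*=N$ for every player. Then $\Pr(E)\ge 1-\delta$, and for every number $T$ of rounds $$\mathbb E[R_T\mid E]\ \le\ T_0N+2e^2N^2 .$$ -/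

import Mathlib

open MeasureTheory ProbabilityTheory

noncomputable section

namespace MusicalChairs

/-! ### Arms, means and rankings -/

/-- The expected reward of arm `i`, whose reward distribution is `ν i`. -/
def mean {K : ℕ} (ν : Fin K → Measure ℝ) (i : Fin K) : ℝ := ∫ x, x ∂(ν i)

/-- The `k`-th largest value of `μ` (counted with multiplicity, `k = 0` being the largest). -/
def kthBest {K : ℕ} (μ : Fin K → ℝ) (k : Fin K) : ℝ :=
  μ (Tuple.sort (fun i => -μ i) k)

/-- The sum of the `N` largest values of `μ` (for `N ≤ K`). -/
def topSum {K : ℕ} (N : ℕ) (μ : Fin K → ℝ) : ℝ :=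
  ∑ k : Fin K, if k.val < N then kthBest μ k else 0

/-- The list of arms `A 0, A 1, …` is an `ε`-correct ranking for the true means `μ`: arm `i` is
listed before arm `i'` whenever `μ i - μ i' > ε`. -/
def IsCorrectRanking {K : ℕ} (ε : ℝ) (μ : Fin K → ℝ) (A : Equiv.Perm (Fin K)) : Prop :=
  ∀ i i' : Fin K, ε < μ i - μ i' → A.symm i < A.symm i'

/-- A sorting procedure: it lists the indices of any vector in order of non-increasing values,
breaking ties by any (measurable) rule. -/
def IsSortingRule {K : ℕ} (sort : (Fin K → ℝ) → Equiv.Perm (Fin K)) : Prop :=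
  (∀ x : Fin K → ℝ, Antitone (x ∘ sort x)) ∧
    ∀ A : Equiv.Perm (Fin K), MeasurableSet {x : Fin K → ℝ | sort x = A}

/-! ### The randomness -/

/-- The randomness of one round: the reward of every arm; for every player a draw from all the
arms; and for every player and every `m < K` a draw from `m + 1` positions `0, …, m`. -/
abbrev Round (K N : ℕ) : Type :=
  (Fin K → ℝ) × (Fin N → Fin K) × (Fin N → (m : Fin K) → Fin (m.val + 1))

/-- The law of one round: all the components are independent, the reward of arm `i` has law `ν i`,
and the draws of the players are uniform. -/
def roundLaw {K : ℕ} (N : ℕ) (ν : Fin K → Measure ℝ) : Measure (Round K N) :=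
  (Measure.pi ν).prod
    ((Measure.pi fun _ : Fin N => (uniformOn Set.univ : Measure (Fin K))).prod
      (Measure.pi fun _ : Fin N => Measure.pi fun m : Fin K =>
        (uniformOn Set.univ : Measure (Fin (m.val + 1)))))

/-- The law of the whole game: the rounds are independent and identically distributed. -/
def gameLaw {K : ℕ} (N : ℕ) (ν : Fin K → Measure ℝ) : Measure (ℕ → Round K N) :=
  Measure.infinitePi fun _ : ℕ => roundLaw N ν

/-- Given the arms chosen by all the players in one round, player `j` has a collision. -/
def Collides {K N : ℕ} (arms : Fin N → Fin K) (j : Fin N) : Prop :=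
  ∃ j' : Fin N, j' ≠ j ∧ arms j' = arms j

/-! ### The learning phase: rounds `0, …, T₀ - 1` -/

/-- The arm which player `j` samples in round `t` of the learning phase. -/
def learnArm {K N : ℕ} (ω : ℕ → Round K N) (t : ℕ) (j : Fin N) : Fin K := (ω t).2.1 j

open Classical in
/-- The number of collisions of player `j` in the learning phase. -/
def collisions {K N : ℕ} (T₀ : ℕ) (ω : ℕ → Round K N) (j : Fin N) : ℕ :=
  ∑ t ∈ Finset.range T₀, if Collides (learnArm ω t) j then 1 else 0

open Classical in
/-- The number of rounds of the learning phase in which player `j` observed a reward of arm `i`. -/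
def observations {K N : ℕ} (T₀ : ℕ) (ω : ℕ → Round K N) (j : Fin N) (i : Fin K) : ℕ :=
  ∑ t ∈ Finset.range T₀, if learnArm ω t j = i ∧ ¬ Collides (learnArm ω t) j then 1 else 0

open Classical in
/-- The sum of the rewards which player `j` received from arm `i` in the learning phase. -/
def rewardSum {K N : ℕ} (T₀ : ℕ) (ω : ℕ → Round K N) (j : Fin N) (i : Fin K) : ℝ :=
  ∑ t ∈ Finset.range T₀,
    if learnArm ω t j = i ∧ ¬ Collides (learnArm ω t) j then (ω t).1 i else 0

/-- The empirical mean of arm `i` for player `j` (equal to `0` if there was no observation). -/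
def empMean {K N : ℕ} (T₀ : ℕ) (ω : ℕ → Round K N) (j : Fin N) (i : Fin K) : ℝ :=
  rewardSum T₀ ω j i / observations T₀ ω j i

/-- The list of arms of player `j`, sorted by her empirical means. -/
def ranking {K N : ℕ} (sort : Fin N → (Fin K → ℝ) → Equiv.Perm (Fin K)) (T₀ : ℕ)
    (ω : ℕ → Round K N) (j : Fin N) : Equiv.Perm (Fin K) :=
  sort j (empMean T₀ ω j)

/-- The estimate `N*` of the number of players made by player `j`. -/
def estimate {K N : ℕ} (T₀ : ℕ) (ω : ℕ → Round K N) (j : Fin N) : ℕ :=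
  if collisions T₀ ω j = T₀ then K
  else (round (Real.log (((T₀ : ℝ) - collisions T₀ ω j) / T₀) / Real.log (1 - 1 / (K : ℝ))
    + 1)).toNat

/-! ### The Musical Chairs phase: rounds `T₀, T₀ + 1, …` -/

/-- The arm which an unfixed player `j` samples in round `t`: uniform among the first `N*` arms of
her list (among all `K` arms if `N* > K`). -/
def sampledArm {K N : ℕ} [NeZero K] (sort : Fin N → (Fin K → ℝ) → Equiv.Perm (Fin K)) (T₀ : ℕ)
    (ω : ℕ → Round K N) (t : ℕ) (j : Fin N) : Fin K :=
  let m : Fin K := ⟨min (estimate T₀ ω j) K - 1, by have := NeZero.pos K; omega⟩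
  ranking sort T₀ ω j (((ω t).2.2 j m).castLE m.isLt)

/-- The arm chosen by a player: the arm on which she is fixed, if any, and a sampled arm
otherwise. -/
def chosen {K N : ℕ} (fixed : Fin N → Option (Fin K)) (sampled : Fin N → Fin K) (j : Fin N) :
    Fin K :=
  (fixed j).getD (sampled j)

open Classical in
/-- The arms on which the players are fixed after `s` rounds of the Musical Chairs phase. A player
who is not fixed becomes fixed on the arm that she chooses as soon as she has no collision, and a
fixed player stays fixed for ever. -/
def fixedArm {K N : ℕ} [NeZero K] (sort : Fin N → (Fin K → ℝ) → Equiv.Perm (Fin K)) (T₀ : ℕ)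
    (ω : ℕ → Round K N) : ℕ → Fin N → Option (Fin K)
  | 0 => fun _ => none
  | s + 1 => fun j =>
      let arms := chosen (fixedArm sort T₀ ω s) (sampledArm sort T₀ ω (T₀ + s))
      if (fixedArm sort T₀ ω s j).isNone ∧ Collides arms j then none else some (arms j)

/-- The arm chosen by player `j` in round `t` of the game, when all the players run the algorithm
with learning phase of length `T₀`. -/
def playedArm {K N : ℕ} [NeZero K] (sort : Fin N → (Fin K → ℝ) → Equiv.Perm (Fin K)) (T₀ : ℕ)
    (ω : ℕ → Round K N) (t : ℕ) (j : Fin N) : Fin K :=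
  if t < T₀ then learnArm ω t j
  else chosen (fixedArm sort T₀ ω (t - T₀)) (sampledArm sort T₀ ω t) j

/-! ### Regret and the parameter `T₀` -/

open Classical in
/-- The regret after `T` rounds, for arms with means `μ`, with respect to the best static
allocation of players to arms; a player who has a collision gets no reward. -/
def regret {K N : ℕ} [NeZero K] (μ : Fin K → ℝ)
    (sort : Fin N → (Fin K → ℝ) → Equiv.Perm (Fin K)) (T₀ T : ℕ) (ω : ℕ → Round K N) : ℝ :=
  ∑ _t ∈ Finset.range T, topSum N μ -
    ∑ t ∈ Finset.range T, ∑ j : Fin N,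
      μ (playedArm sort T₀ ω t j) *
        (1 - if Collides (playedArm sort T₀ ω t) j then (1 : ℝ) else 0)

/-- The event that after the learning phase every player has an `ε`-correct ranking and a correct
estimate of the number of players. -/
def goodEvent {K N : ℕ} (ε : ℝ) (μ : Fin K → ℝ)
    (sort : Fin N → (Fin K → ℝ) → Equiv.Perm (Fin K)) (T₀ : ℕ) : Set (ℕ → Round K N) :=
  {ω | ∀ j : Fin N, IsCorrectRanking ε μ (ranking sort T₀ ω j) ∧ estimate T₀ ω j = N}

/-- The length of the learning phase, where `δ₂` is the failure probability that is allowed for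
each player's estimate of the number of players. -/
def learningTime (K : ℕ) (ε δ δ₂ : ℝ) : ℕ :=
  ⌈max (max ((K : ℝ) / 2 * Real.log (2 * (K : ℝ) ^ 2 / δ))
      (16 * (K : ℝ) / ε ^ 2 * Real.log (4 * (K : ℝ) ^ 2 / δ)))
    ((K : ℝ) ^ 2 * Real.log (2 / δ₂) / 0.02)⌉₊

end MusicalChairs

end

open MeasureTheory ProbabilityTheory

noncomputable section

namespace MusicalChairs

/-! ### The law of one round -/

/-! Learning phase. A player is alone on a given arm with probability `aloneProb K N ≥ 1/(eK)`. For
each player, arm and sign, let each observation contribute `±(reward - mean) - ε/2` and every other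
round `0`. If both signed sums are negative, the arm has been observed and its empirical mean is
within `ε/2` of the truth. A single Chernoff bound for these masked sums (`mgf_deviation_le`,
`measure_sum_deviation_le`) therefore controls the random number of observations and the error
together. For `N*`, Hoeffding's inequality puts the collision frequency within `0.142/K` of `1 - (1
- 1/K)^(N-1)`, and the logarithm is stable enough there for rounding to return `N` (`estimate_eq`).
A union bound gives `one_sub_le_goodEvent`.

Musical Chairs phase. Since `ε < Δ`, on the good event the first `N` places of every list hold the
same set of `N` best arms (`mem_bestArms_iff`), possibly in different orders. Fixed players sit on
distinct best arms, so the regret of a round is at most the number of colliding players, hence at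
most twice the number of unfixed ones (`sum_sub_reward_le`, `card_collides_le`). An unfixed player
always has a free best arm and, whatever the past, gets fixed with probability at least `aloneProb N
N ≥ 1/(eN)`. She thus stays unfixed for at most `eN` rounds on average, which gives `2eN²` in total.
The good event is decided by the learning rounds, hence independent of the later draws; the
estimates are made on intersections with it, and its probability is divided out only at the end. -/

theorem uniformOn_univ_real {α : Type*} [Fintype α] [Nonempty α] [MeasurableSpace α]
    [MeasurableSingletonClass α] (x : α) :
    (uniformOn Set.univ : Measure α).real {x} = 1 / Fintype.card α ∧
      (uniformOn Set.univ : Measure α).real {x}ᶜ = 1 - 1 / Fintype.card α := by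
  have hp : IsProbabilityMeasure (uniformOn Set.univ : Measure α) :=
    isProbabilityMeasure_uniformOn Set.finite_univ Set.univ_nonempty
  have h : (uniformOn Set.univ : Measure α).real {x} = 1 / Fintype.card α := by
    simp [measureReal_def, uniformOn_univ]
  exact ⟨h, by rw [probReal_compl_eq_one_sub (measurableSet_singleton x), h]⟩

instance uniformOn_univ_isProbabilityMeasure {α : Type*} [Finite α] [Nonempty α]
    [MeasurableSpace α] [MeasurableSingletonClass α] :
    IsProbabilityMeasure (uniformOn Set.univ : Measure α) :=
  isProbabilityMeasure_uniformOn Set.finite_univ Set.univ_nonempty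

/-- The probability that among `N` independent uniform draws exactly the `j`-th one hits its
target. -/
theorem pi_uniformOn_only_hit {α : Type*} [Fintype α] [Nonempty α] [MeasurableSpace α]
    [MeasurableSingletonClass α] {N : ℕ} (x : Fin N → α) (j : Fin N) :
    (Measure.pi fun _ : Fin N => (uniformOn Set.univ : Measure α)).real
      {d | d j = x j ∧ ∀ j', j' ≠ j → d j' ≠ x j'} =
      1 / Fintype.card α * (1 - 1 / (Fintype.card α : ℝ)) ^ (N - 1) := by
  classical
  have h : {d : Fin N → α | d j = x j ∧ ∀ j', j' ≠ j → d j' ≠ x j'} =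
      Set.pi Set.univ (fun j' => if j' = j then {x j'} else {x j'}ᶜ) := by
    ext d
    simp only [Set.mem_ofPred_eq, Set.mem_pi, Set.mem_univ, forall_const]
    constructor
    · rintro ⟨h1, h2⟩ j'
      by_cases hj : j' = j
      · subst hj; simpa using h1
      · simpa [hj] using h2 j' hj
    · intro h
      refine ⟨by simpa using h j, fun j' hj => by simpa [hj] using h j'⟩
  rw [h, measureReal_def, Measure.pi_pi, ENNReal.toReal_prod,
    ← Finset.mul_prod_erase _ _ (Finset.mem_univ j)]
  congr 1
  · simpa [measureReal_def] using (uniformOn_univ_real (x j)).1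
  · rw [Finset.prod_congr rfl (g := fun _ => 1 - 1 / (Fintype.card α : ℝ))]
    · simp
    · intro j' hj'
      have : j' ≠ j := Finset.ne_of_mem_erase hj'
      simpa [this, measureReal_def] using (uniformOn_univ_real (x j')).2

section

variable {K N : ℕ} (ν : Fin K → Measure ℝ) [∀ i, IsProbabilityMeasure (ν i)]

theorem measurePreserving_learn :
    MeasurePreserving (fun ρ : Round K N => ρ.2.1) (roundLaw N ν)
      (Measure.pi fun _ : Fin N => (uniformOn Set.univ : Measure (Fin K))) :=
  measurePreserving_fst.comp measurePreserving_snd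

variable [NeZero K]

instance roundLaw_isProbabilityMeasure : IsProbabilityMeasure (roundLaw N ν) := by
  unfold roundLaw; infer_instance

instance gameLaw_isProbabilityMeasure : IsProbabilityMeasure (gameLaw N ν) := by
  unfold gameLaw; infer_instance

theorem measurePreserving_draw (m : Fin K) :
    MeasurePreserving (fun (ρ : Round K N) j => ρ.2.2 j m) (roundLaw N ν)
      (Measure.pi fun _ : Fin N => (uniformOn Set.univ : Measure (Fin (m.val + 1)))) :=
  (measurePreserving_pi (μ := fun _ : Fin N => Measure.pi fun m : Fin K =>
      (uniformOn Set.univ : Measure (Fin (m.val + 1))))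
    (ν := fun _ : Fin N => (uniformOn Set.univ : Measure (Fin (m.val + 1))))
    (f := fun _ d => d m)
    (fun _ => measurePreserving_eval (fun m : Fin K =>
      (uniformOn Set.univ : Measure (Fin (m.val + 1)))) m)).comp
    (measurePreserving_snd.comp measurePreserving_snd)

theorem measurePreserving_round (t : ℕ) :
    MeasurePreserving (fun ω : ℕ → Round K N => ω t) (gameLaw N ν) (roundLaw N ν) :=
  measurePreserving_eval_infinitePi (fun _ : ℕ => roundLaw N ν) t

theorem iIndepFun_rounds {β : Type*} [MeasurableSpace β] {f : Round K N → β}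
    (hf : Measurable f) :
    iIndepFun (fun (t : ℕ) (ω : ℕ → Round K N) => f (ω t)) (gameLaw N ν) :=
  iIndepFun_infinitePi (fun _ => hf)

/-- The probability that a given player is the only one to choose a given arm. -/
def aloneProb (K N : ℕ) : ℝ := 1 / K * (1 - 1 / (K : ℝ)) ^ (N - 1)

theorem learn_only_hit (j : Fin N) (i : Fin K) :
    (Measure.pi fun _ : Fin N => (uniformOn Set.univ : Measure (Fin K))).real
      {d | d j = i ∧ ¬ Collides d j} = aloneProb K N := by
  have h := pi_uniformOn_only_hit (fun _ : Fin N => i) j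
  rw [Fintype.card_fin] at h
  rw [aloneProb, ← h]
  congr 1
  ext d
  simp only [Collides, Set.mem_ofPred_eq, not_exists, not_and]
  constructor
  · rintro ⟨h, h'⟩; exact ⟨h, fun j' hj => h ▸ h' j' hj⟩
  · rintro ⟨h, h'⟩; exact ⟨h, fun j' hj => h.symm ▸ h' j' hj⟩

/-- Having no collision is the disjoint union over the `K` arms of being alone on that arm, so the
factor `1/K` of `aloneProb` cancels. -/
theorem learn_collides (j : Fin N) :
    (Measure.pi fun _ : Fin N => (uniformOn Set.univ : Measure (Fin K))).real
      {d | Collides d j} = 1 - (1 - 1 / (K : ℝ)) ^ (N - 1) := by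
  have hK : (K : ℝ) ≠ 0 := Nat.cast_ne_zero.2 (NeZero.ne K)
  have h1 : {d : Fin N → Fin K | Collides d j}ᶜ =
      ⋃ i ∈ (Finset.univ : Finset (Fin K)), {d | d j = i ∧ ¬ Collides d j} := by
    ext d; simp
  have h2 := probReal_compl_eq_one_sub
    (μ := Measure.pi fun _ : Fin N => (uniformOn Set.univ : Measure (Fin K)))
    (s := {d | Collides d j}) (MeasurableSet.of_discrete)
  rw [h1, measureReal_biUnion_finset] at h2
  · simp only [learn_only_hit, Finset.sum_const, Finset.card_univ, Fintype.card_fin,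
      nsmul_eq_mul, aloneProb] at h2
    rw [← mul_assoc, mul_one_div_cancel hK] at h2
    linarith
  · intro i _ i' _ hii
    refine Set.disjoint_left.2 ?_
    rintro d ⟨h, -⟩ ⟨h', -⟩
    exact hii (h.symm.trans h')
  · intro i _; exact MeasurableSet.of_discrete

theorem aloneProb_nonneg : 0 ≤ aloneProb K N := by
  have hK : (1 : ℝ) ≤ K := by exact_mod_cast NeZero.one_le
  have : 1 / (K : ℝ) ≤ 1 := by rw [div_le_one (by linarith)]; exact hK
  exact mul_nonneg (by positivity) (pow_nonneg (by linarith) _)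

end

/-- `(1 - 1/n) ^ m ≥ 1/e` for `m ≤ n - 1`. -/
theorem exp_neg_one_le_pow {n m : ℕ} (h : m + 1 ≤ n) :
    Real.exp (-1) ≤ (1 - 1 / (n : ℝ)) ^ m := by
  have hn : (m : ℝ) + 1 ≤ n := by exact_mod_cast h
  have hm : (0 : ℝ) ≤ m := m.cast_nonneg
  rcases Nat.eq_zero_or_pos m with rfl | hm0
  · simp
  have hm1 : (1 : ℝ) ≤ m := by exact_mod_cast hm0
  have hx : (0 : ℝ) < 1 - 1 / (n : ℝ) := by
    rw [sub_pos, div_lt_one (by linarith)]; linarith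
  -- `(1 - 1/n)⁻¹ = 1 + 1/(n-1) ≤ 1 + 1/m ≤ exp (1/m)`; the `m`-th power of this is the claim.
  have h1 : (1 - 1 / (n : ℝ))⁻¹ ≤ Real.exp (1 / m) := by
    refine le_trans ?_ (Real.add_one_le_exp _)
    rw [inv_le_iff_one_le_mul₀ hx]
    have hm' : (0 : ℝ) < m := by linarith
    have hn' : (0 : ℝ) < n := by linarith
    have : (1 / (m : ℝ) + 1) * (1 - 1 / (n : ℝ)) - 1 = (n - (m + 1)) / (m * n) := by
      field_simp; ring
    have : 0 ≤ (n - ((m : ℝ) + 1)) / (m * n) := div_nonneg (by linarith) (by positivity)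
    linarith
  have h2 : ((1 - 1 / (n : ℝ))⁻¹) ^ m ≤ Real.exp 1 := by
    calc _ ≤ Real.exp (1 / m) ^ m := pow_le_pow_left₀ (by positivity) h1 m
      _ = Real.exp 1 := by
        rw [← Real.exp_nat_mul, mul_one_div_cancel (by linarith)]
  rw [Real.exp_neg, inv_le_comm₀ (Real.exp_pos 1) (pow_pos hx m), ← inv_pow]
  exact h2

/-! ### Concentration in the learning phase -/

section

variable {K N : ℕ} (ν : Fin K → Measure ℝ) [∀ i, IsProbabilityMeasure (ν i)]

open Classical in
/-- The contribution of one round to the deviation of an empirical mean. -/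
def deviation (Y : ℝ → ℝ) (j : Fin N) (i : Fin K) (c : ℝ) (ρ : Round K N) : ℝ :=
  if ρ.2.1 j = i ∧ ¬ Collides ρ.2.1 j then Y (ρ.1 i) - c else 0

theorem measurable_deviation {Y : ℝ → ℝ} (hY : Measurable Y) (j : Fin N) (i : Fin K) (c : ℝ) :
    Measurable (deviation Y j i c) := by
  unfold deviation
  refine Measurable.ite ?_ ?_ measurable_const
  · exact (MeasurableSet.of_discrete (s := {d : Fin N → Fin K | d j = i ∧ ¬ Collides d j})).preimage
      (measurable_fst.comp measurable_snd)
  · exact (hY.comp ((measurable_pi_apply i).comp measurable_fst)).sub_const c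

variable [NeZero K]

/-- A round without observation contributes the factor `1`. An observation contributes at most `exp
(λ²/8 - λε/2)`, because the reward is independent of the choices of arms; `λ = 2ε` minimises this
and gives `exp (-ε²/2)`. -/
theorem mgf_deviation_le {Y : ℝ → ℝ} {i : Fin K}
    (hsub : HasSubgaussianMGF Y (1 / 4) (ν i)) (j : Fin N) (ε : ℝ) :
    Integrable (fun ρ => Real.exp (2 * ε * deviation Y j i (ε / 2) ρ)) (roundLaw N ν) ∧
    mgf (deviation Y j i (ε / 2)) (roundLaw N ν) (2 * ε) ≤
      1 - aloneProb K N * (1 - Real.exp (-(ε ^ 2 / 2))) := by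
  classical
  set O : Set (Fin N → Fin K) := {d | d j = i ∧ ¬ Collides d j} with hO
  set g : ℝ → ℝ := fun x => Real.exp (2 * ε * (Y x - ε / 2)) - 1 with hg
  -- In this form the reward and the choices of arms appear as a product, which the product measure
  -- integrates factor by factor.
  have hpt : ∀ ρ : Round K N, Real.exp (2 * ε * deviation Y j i (ε / 2) ρ) =
      1 + g (ρ.1 i) * O.indicator (fun _ => (1 : ℝ)) ρ.2.1 := by
    intro ρ
    by_cases h : ρ.2.1 ∈ O
    · have h' : ρ.2.1 j = i ∧ ¬ Collides ρ.2.1 j := h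
      simp [deviation, h, h', hg]
    · have h' : ¬ (ρ.2.1 j = i ∧ ¬ Collides ρ.2.1 j) := h
      simp only [deviation, h', if_false, Set.indicator_of_notMem h]
      simp
  have hexp : ∀ x, Real.exp (2 * ε * (Y x - ε / 2)) =
      Real.exp (-ε ^ 2) * Real.exp (2 * ε * Y x) := by
    intro x; rw [← Real.exp_add]; congr 1; ring
  have hgint : Integrable g (ν i) := by
    refine Integrable.sub ?_ (integrable_const _)
    simp_rw [hexp]
    exact (hsub.integrable_exp_mul _).const_mul _
  have hgle : ∫ x, g x ∂(ν i) ≤ Real.exp (-(ε ^ 2 / 2)) - 1 := by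
    rw [hg, integral_sub _ (integrable_const _)]
    · simp_rw [hexp]
      rw [integral_const_mul]
      have h1 := hsub.mgf_le (2 * ε)
      have h2 : Real.exp (-ε ^ 2) * mgf Y (ν i) (2 * ε) ≤
          Real.exp (-ε ^ 2) * Real.exp (((1 / 4 : NNReal) : ℝ) * (2 * ε) ^ 2 / 2) :=
        mul_le_mul_of_nonneg_left h1 (Real.exp_pos _).le
      rw [← Real.exp_add] at h2
      have h3 : -ε ^ 2 + ((1 / 4 : NNReal) : ℝ) * (2 * ε) ^ 2 / 2 = -(ε ^ 2 / 2) := by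
        push_cast; ring
      rw [h3] at h2
      simp only [integral_const, probReal_univ, smul_eq_mul, mul_one]
      exact sub_le_sub_right h2 1
    · simp_rw [hexp]
      exact (hsub.integrable_exp_mul _).const_mul _
  have hOint : Integrable (O.indicator (fun _ => (1 : ℝ)))
      (Measure.pi fun _ : Fin N => (uniformOn Set.univ : Measure (Fin K))) :=
    (integrable_const _).indicator MeasurableSet.of_discrete
  have hG : Integrable (fun x : Fin K → ℝ => g (x i)) (Measure.pi ν) :=
    (measurePreserving_eval ν i).integrable_comp_of_integrable hgint
  have hH : Integrable (fun y : (Fin N → Fin K) × (Fin N → (m : Fin K) → Fin (m.val + 1)) =>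
      O.indicator (fun _ => (1 : ℝ)) y.1)
      ((Measure.pi fun _ : Fin N => (uniformOn Set.univ : Measure (Fin K))).prod
      (Measure.pi fun _ : Fin N => Measure.pi fun m : Fin K =>
        (uniformOn Set.univ : Measure (Fin (m.val + 1))))) :=
    measurePreserving_fst.integrable_comp_of_integrable hOint
  have hint : Integrable (fun ρ : Round K N => g (ρ.1 i) * O.indicator (fun _ => (1 : ℝ)) ρ.2.1)
      (roundLaw N ν) := hG.mul_prod hH
  refine ⟨?_, ?_⟩
  · simp_rw [hpt]
    exact (integrable_const _).add hint
  · have hval : ∫ ρ : Round K N, g (ρ.1 i) * O.indicator (fun _ => (1 : ℝ)) ρ.2.1 ∂(roundLaw N ν)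
        = (∫ x, g x ∂(ν i)) * aloneProb K N := by
      unfold roundLaw
      rw [integral_prod_mul (fun x : Fin K → ℝ => g (x i))
        (fun y : (Fin N → Fin K) × (Fin N → (m : Fin K) → Fin (m.val + 1)) =>
          O.indicator (fun _ => (1 : ℝ)) y.1)]
      congr 1
      · exact integral_comp_eval (μ := ν) (i := i) hgint.aestronglyMeasurable
      · rw [integral_fun_fst (f := O.indicator (fun _ => (1 : ℝ))),
          integral_indicator_const _ MeasurableSet.of_discrete]
        simp only [probReal_univ, smul_eq_mul, mul_one, one_mul]
        exact learn_only_hit j i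
    unfold mgf
    simp_rw [hpt]
    rw [integral_add (integrable_const _) hint, hval]
    simp only [integral_const, probReal_univ, smul_eq_mul, mul_one]
    nlinarith [mul_le_mul_of_nonneg_right hgle (aloneProb_nonneg (K := K) (N := N))]

/-- Chernoff bound at threshold `0`. Too few observations and atypical rewards are covered by the
same event, so no conditioning on the number of observations is needed. -/
theorem measure_sum_deviation_le {Y : ℝ → ℝ} (hY : Measurable Y) {i : Fin K}
    (hsub : HasSubgaussianMGF Y (1 / 4) (ν i)) (j : Fin N) {ε : ℝ} (hε : 0 ≤ ε) (T : ℕ) :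
    (gameLaw N ν).real {ω | 0 ≤ ∑ t ∈ Finset.range T, deviation Y j i (ε / 2) (ω t)} ≤
      Real.exp (-(T * (aloneProb K N * (1 - Real.exp (-(ε ^ 2 / 2)))))) := by
  obtain ⟨hint, hmgf⟩ := mgf_deviation_le ν hsub j ε
  have hm := measurable_deviation hY j i (ε / 2)
  set X : ℕ → (ℕ → Round K N) → ℝ := fun t ω => deviation Y j i (ε / 2) (ω t) with hX
  have hXm : ∀ t, Measurable (X t) := fun t => hm.comp (measurable_pi_apply t)
  have hindep : iIndepFun X (gameLaw N ν) := iIndepFun_rounds ν hm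
  have hXint : ∀ t, Integrable (fun ω => Real.exp (2 * ε * X t ω)) (gameLaw N ν) := fun t =>
    (measurePreserving_round ν t).integrable_comp_of_integrable hint
  have hXmgf : ∀ t, mgf (X t) (gameLaw N ν) (2 * ε) =
      mgf (deviation Y j i (ε / 2)) (roundLaw N ν) (2 * ε) := by
    intro t
    have h := (measurePreserving_round (N := N) ν t).map_eq
    unfold mgf
    rw [← h, integral_map (measurable_pi_apply t).aemeasurable]
    rw [h]; exact hint.aestronglyMeasurable
  have hch := measure_ge_le_exp_mul_mgf (μ := gameLaw N ν)
    (X := ∑ t ∈ Finset.range T, X t) 0 (t := 2 * ε) (by linarith)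
    (hindep.integrable_exp_mul_sum hXm (fun t _ => hXint t))
  rw [hindep.mgf_sum hXm] at hch
  simp only [hXmgf, Finset.prod_const, Finset.card_range, mul_zero, Real.exp_zero, one_mul,
    Finset.sum_apply] at hch
  refine hch.trans ?_
  set a := aloneProb K N * (1 - Real.exp (-(ε ^ 2 / 2)))
  have : (1 : ℝ) - a ≤ Real.exp (-a) := Real.one_sub_le_exp_neg a
  calc _ ≤ Real.exp (-a) ^ T := pow_le_pow_left₀ mgf_nonneg (hmgf.trans this) T
    _ = _ := by rw [← Real.exp_nat_mul]; ring_nf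

open Classical in
-- Hoeffding's inequality for the collision indicators; the sign `s` selects the tail.
theorem measure_collisions_deviation_le (j : Fin N) {r : ℝ} (hr : 0 ≤ r) (T : ℕ) (s : ℝ)
    (hs : s = 1 ∨ s = -1) :
    (gameLaw N ν).real {ω | r ≤
      s * (collisions T ω j - T * (1 - (1 - 1 / (K : ℝ)) ^ (N - 1)))} ≤
      Real.exp (-(2 * r ^ 2 / T)) := by
  set f : Round K N → ℝ := fun ρ => if Collides ρ.2.1 j then 1 else 0 with hf
  set O : Set (Fin N → Fin K) := {d | Collides d j} with hO
  have hfO : f = fun ρ => O.indicator (fun _ => (1 : ℝ)) ρ.2.1 := by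
    ext ρ; simp [hf, hO, Set.indicator_apply]
  have hfm : Measurable f := by
    rw [hfO]
    exact (measurable_const.indicator MeasurableSet.of_discrete).comp
      (measurable_fst.comp measurable_snd)
  have hmean : ∫ ρ, f ρ ∂(roundLaw N ν) = 1 - (1 - 1 / (K : ℝ)) ^ (N - 1) := by
    rw [hfO, ← integral_map (φ := fun ρ : Round K N => ρ.2.1)
      (f := O.indicator (fun _ => (1 : ℝ))), (measurePreserving_learn ν).map_eq,
      integral_indicator_const _ MeasurableSet.of_discrete]
    · simpa using learn_collides j
    · exact (measurable_fst.comp measurable_snd).aemeasurable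
    · exact (measurable_const.indicator MeasurableSet.of_discrete).aestronglyMeasurable
  set p : ℝ := 1 - (1 - 1 / (K : ℝ)) ^ (N - 1)
  have hsub : HasSubgaussianMGF (fun ρ => f ρ - p) (1 / 4) (roundLaw N ν) := by
    have h := hasSubgaussianMGF_of_mem_Icc (μ := roundLaw N ν) (X := f) (a := 0) (b := 1)
      hfm.aemeasurable (Filter.Eventually.of_forall fun ρ => by
        simp only [hf]; split_ifs <;> simp)
    rw [hmean] at h
    have e : ((‖(1 : ℝ) - 0‖₊ / 2) ^ 2 : NNReal) = 1 / 4 := by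
      ext; push_cast; norm_num
    rwa [e] at h
  have hsub' : HasSubgaussianMGF (fun ρ => s * (f ρ - p)) (1 / 4) (roundLaw N ν) := by
    rcases hs with rfl | rfl
    · simpa using hsub
    · simpa [Pi.neg_def] using hsub.neg
  have hsubG : ∀ t < T, HasSubgaussianMGF
      (fun ω : ℕ → Round K N => s * (f (ω t) - p)) (1 / 4) (gameLaw N ν) := by
    intro t _
    refine HasSubgaussianMGF.of_map (X := fun ρ => s * (f ρ - p)) (Y := fun ω : ℕ → Round K N => ω t)
      (measurable_pi_apply t).aemeasurable ?_
    rw [(measurePreserving_round ν t).map_eq]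
    exact hsub'
  have h := HasSubgaussianMGF.measure_sum_range_ge_le_of_iIndepFun
    (iIndepFun_rounds ν ((hfm.sub_const p).const_mul s)) hsubG hr
  have hset : {ω : ℕ → Round K N | r ≤ s * ((collisions T ω j : ℝ) - T * p)} =
      {ω | r ≤ ∑ t ∈ Finset.range T, s * (f (ω t) - p)} := by
    ext ω
    simp only [Set.mem_ofPred_eq, ← Finset.mul_sum, Finset.sum_sub_distrib, collisions, hf,
      Finset.sum_const, Finset.card_range, nsmul_eq_mul]
    push_cast
    rfl
  rw [hset]
  refine h.trans_eq ?_
  congr 1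
  push_cast
  -- For `T = 0` both exponents are `0`, since division by zero gives `0`.
  rcases Nat.eq_zero_or_pos T with rfl | hT
  · simp
  · have : (T : ℝ) ≠ 0 := by positivity
    field_simp
    ring

end

/-! ### The estimate of the number of players -/

/-- With `q = 1 - 1/K` and `y = q^(N-1)` one has `log y / log q = N - 1` exactly. The frequency `x`
of collision-free rounds is within `0.142/K` of `y > 0.367`, so `log x` is within `1/(2K)` of `log
y`. As `|log q| ≥ 1/K`, the number to be rounded differs from `N` by less than `1/2`. -/
theorem estimate_eq {K N : ℕ} (hK : 2 ≤ K) (hN : 1 ≤ N) (hNK : N < K) {T : ℕ} (hT : 0 < T)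
    {ω : ℕ → Round K N} {j : Fin N}
    (h1 : collisions T ω j - T * (1 - (1 - 1 / (K : ℝ)) ^ (N - 1)) < T * (71 / (500 * K)))
    (h2 : -(collisions T ω j - T * (1 - (1 - 1 / (K : ℝ)) ^ (N - 1))) < T * (71 / (500 * K))) :
    estimate T ω j = N := by
  have hK' : (2 : ℝ) ≤ K := by exact_mod_cast hK
  have hT' : (0 : ℝ) < T := by exact_mod_cast hT
  have hK0 : (0 : ℝ) < K := by linarith
  set C : ℝ := ((collisions T ω j : ℕ) : ℝ) with hC
  set q : ℝ := 1 - 1 / (K : ℝ) with hq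
  set y : ℝ := q ^ (N - 1) with hy
  set x : ℝ := ((T : ℝ) - C) / T with hx
  have hq0 : 0 < q := by
    rw [hq, sub_pos, div_lt_one hK0]; linarith
  have hlogq : Real.log q ≤ -(1 / K) := by
    have := Real.log_le_sub_one_of_pos hq0
    linarith
  have hKinv : 0 < 1 / (K : ℝ) := by positivity
  have hKinv2 : 1 / (K : ℝ) ≤ 1 / 2 := one_div_le_one_div_of_le (by norm_num) hK'
  set u : ℝ := 1 / (K : ℝ) with hu
  have hr : 71 / (500 * (K : ℝ)) = 71 / 500 * u := by rw [hu]; field_simp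
  have hye : Real.exp (-1) ≤ y := exp_neg_one_le_pow (by omega)
  have hy367 : 0.367 < y := lt_of_lt_of_le (by
    have := Real.exp_neg_one_gt_d9; linarith) hye
  have hxT : C = T * (1 - x) := by rw [hx]; field_simp; ring
  rw [hr] at h1 h2
  have hx1 : x - y < 71 / 500 * u := by
    rw [hxT] at h2
    have : (T : ℝ) * (x - y) < T * (71 / 500 * u) := by linarith
    exact lt_of_mul_lt_mul_left this hT'.le
  have hx2 : y - x < 71 / 500 * u := by
    rw [hxT] at h1
    have : (T : ℝ) * (y - x) < T * (71 / 500 * u) := by linarith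
    exact lt_of_mul_lt_mul_left this hT'.le
  have hy0 : 0 < y := by linarith
  have hx0 : 0 < x := by linarith
  have hCT : collisions T ω j ≠ T := by
    intro h
    have : C = T := by rw [hC, h]
    rw [hx, this] at hx0
    simp at hx0
  have hlogy : Real.log y = ((N : ℝ) - 1) * Real.log q := by
    rw [hy, Real.log_pow, Nat.cast_sub hN]; simp
  have hup : Real.log x - Real.log y < u / 2 := by
    rw [← Real.log_div hx0.ne' hy0.ne']
    have h := Real.log_le_sub_one_of_pos (div_pos hx0 hy0)
    have h' : x / y - 1 = (x - y) / y := by field_simp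
    have h'' : (x - y) / y < u / 2 := by
      rw [div_lt_iff₀ hy0]
      nlinarith
    linarith
  -- The tighter side: here the denominator is `x`, and `K ≥ 2` gives only `x > 0.367 - 0.071 =
  -- 0.296`; still `0.142/0.296 < 1/2`.
  have hlow : Real.log y - Real.log x < u / 2 := by
    rw [← Real.log_div hy0.ne' hx0.ne']
    have h := Real.log_le_sub_one_of_pos (div_pos hy0 hx0)
    have h' : y / x - 1 = (y - x) / x := by field_simp
    have h'' : (y - x) / x < u / 2 := by
      rw [div_lt_iff₀ hx0]
      nlinarith
    linarith
  have hlq : Real.log q < 0 := by linarith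
  have hval : (Real.log x / Real.log q + 1) =
      N + (Real.log x - Real.log y) / Real.log q := by
    have hne := hlq.ne
    rw [hlogy]; field_simp; ring
  have hround : round (Real.log x / Real.log q + 1) = (N : ℤ) := by
    rw [hval, round_eq, Int.floor_eq_iff]
    have a1 : (Real.log x - Real.log y) / Real.log q < 1 / 2 := by
      rw [div_lt_iff_of_neg hlq]; linarith
    have a2 : -(1 / 2) < (Real.log x - Real.log y) / Real.log q := by
      rw [lt_div_iff_of_neg hlq]; linarith
    push_cast
    constructor <;> linarith
  rw [estimate, if_neg hCT, hround, Int.toNat_natCast]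

/-! ### Correct rankings -/

theorem sum_deviation {K N : ℕ} (s m c : ℝ) (T : ℕ) (ω : ℕ → Round K N) (j : Fin N) (i : Fin K) :
    ∑ t ∈ Finset.range T, deviation (fun x => s * (x - m)) j i c (ω t) =
      s * (rewardSum T ω j i - observations T ω j i * m) - observations T ω j i * c := by
  classical
  simp only [rewardSum, observations, Nat.cast_sum, Finset.sum_mul, ← Finset.sum_sub_distrib,
    Finset.mul_sum]
  refine Finset.sum_congr rfl fun t _ => ?_
  have e : (learnArm ω t) = (ω t).2.1 := rfl
  simp only [deviation, e]
  split_ifs <;> simp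

/-- By `sum_deviation`, the two signs say that `n` times the error of the empirical mean is below
`nε/2` in absolute value, `n` being the number of observations. Two errors below `ε/2` cannot
reverse a gap above `ε`. -/
theorem isCorrectRanking_of_sum_deviation_neg {K N : ℕ} {ε : ℝ} (hε : 0 < ε) {μ : Fin K → ℝ}
    {sort : Fin N → (Fin K → ℝ) → Equiv.Perm (Fin K)} {T : ℕ} {ω : ℕ → Round K N} {j : Fin N}
    (hsort : IsSortingRule (sort j))
    (h : ∀ i, ∀ s : ℝ, (s = 1 ∨ s = -1) →
      ∑ t ∈ Finset.range T, deviation (fun x => s * (x - μ i)) j i (ε / 2) (ω t) < 0) :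
    IsCorrectRanking ε μ (ranking sort T ω j) := by
  have hemp : ∀ i, empMean T ω j i - μ i < ε / 2 ∧ μ i - empMean T ω j i < ε / 2 := by
    intro i
    have h1 := h i 1 (Or.inl rfl)
    have h2 := h i (-1) (Or.inr rfl)
    rw [sum_deviation] at h1 h2
    set n : ℝ := ((observations T ω j i : ℕ) : ℝ) with hn
    -- Adding the two strict inequalities gives `-nε < 0`: an unobserved arm would make both sums
    -- equal to `0`.
    have hn0 : 0 < n := by
      have : 0 < n * ε := by linarith
      exact pos_of_mul_pos_left this hε.le
    have e : rewardSum T ω j i = n * empMean T ω j i := by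
      rw [empMean, ← hn]; field_simp
    rw [e] at h1 h2
    constructor
    · refine lt_of_mul_lt_mul_left (a := n) ?_ hn0.le
      linarith
    · refine lt_of_mul_lt_mul_left (a := n) ?_ hn0.le
      linarith
  intro i i' hii
  by_contra hcon
  have hle : (ranking sort T ω j).symm i' ≤ (ranking sort T ω j).symm i := not_lt.1 hcon
  have hanti := hsort.1 (empMean T ω j) hle
  have hr : ranking sort T ω j = sort j (empMean T ω j) := rfl
  simp only [Function.comp_apply, ← hr, Equiv.apply_symm_apply] at hanti
  linarith [(hemp i).1, (hemp i').2, (hemp i).2, (hemp i').1]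

/-! ### The probability of the good event -/

theorem sum_deviation_nonneg_prob {K N : ℕ} [NeZero K] (hNK : N ≤ K) (ν : Fin K → Measure ℝ)
    [∀ i, IsProbabilityMeasure (ν i)] (hsupp : ∀ i, ∀ᵐ x ∂(ν i), x ∈ Set.Icc (0 : ℝ) 1)
    {ε δ : ℝ} (hε : 0 < ε) (hε1 : ε ≤ 1) (hδ : 0 < δ) {T : ℕ}
    (hT : 16 * (K : ℝ) / ε ^ 2 * Real.log (4 * (K : ℝ) ^ 2 / δ) ≤ T)
    (hlog : 0 ≤ Real.log (4 * (K : ℝ) ^ 2 / δ))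
    (j : Fin N) (i : Fin K) {s : ℝ} (hs : s = 1 ∨ s = -1) :
    (gameLaw N ν).real {ω | 0 ≤ ∑ t ∈ Finset.range T,
      deviation (fun x => s * (x - mean ν i)) j i (ε / 2) (ω t)} ≤ δ / (4 * (K : ℝ) ^ 2) := by
  have hK0 : (0 : ℝ) < K := Nat.cast_pos.2 (NeZero.pos K)
  have hsub : HasSubgaussianMGF (fun x => s * (x - mean ν i)) (1 / 4) (ν i) := by
    have h := hasSubgaussianMGF_of_mem_Icc (μ := ν i) (X := fun x => x) (a := 0) (b := 1)
      aemeasurable_id (hsupp i)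
    have e : ((‖(1 : ℝ) - 0‖₊ / 2) ^ 2 : NNReal) = 1 / 4 := by
      ext; push_cast; norm_num
    rw [e] at h
    rcases hs with rfl | rfl
    · simpa [mean] using h
    · simpa [Pi.neg_def, mean] using h.neg
  refine (measure_sum_deviation_le ν (by fun_prop) hsub j hε.le T).trans ?_
  set l := Real.log (4 * (K : ℝ) ^ 2 / δ) with hl
  have hpos : 0 < 4 * (K : ℝ) ^ 2 / δ := by positivity
  have hel : Real.exp (-l) = δ / (4 * (K : ℝ) ^ 2) := by
    rw [Real.exp_neg, hl, Real.exp_log hpos, inv_div]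
  rw [← hel]
  refine Real.exp_le_exp.2 (neg_le_neg ?_)
  have hp : 0.367 / K ≤ aloneProb K N := by
    have hN1 : 1 ≤ N := Nat.one_le_iff_ne_zero.2 (by rintro rfl; exact j.elim0)
    have h1 : Real.exp (-1) ≤ (1 - 1 / (K : ℝ)) ^ (N - 1) := exp_neg_one_le_pow (by omega)
    have h2 : 0.367 ≤ (1 - 1 / (K : ℝ)) ^ (N - 1) :=
      le_trans (by have := Real.exp_neg_one_gt_d9; linarith) h1
    rw [aloneProb, div_mul_eq_mul_div, one_mul]
    exact div_le_div_of_nonneg_right h2 hK0.le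
  -- `1 - exp (-z) ≥ z/(1+z)` at `z = ε²/2` is `ε²/(2+ε²)`, and `ε ≤ 1`.
  have hx : ε ^ 2 / 3 ≤ 1 - Real.exp (-(ε ^ 2 / 2)) := by
    have h1 : ε ^ 2 / 2 + 1 ≤ Real.exp (ε ^ 2 / 2) := Real.add_one_le_exp _
    have h2 : Real.exp (-(ε ^ 2 / 2)) ≤ (ε ^ 2 / 2 + 1)⁻¹ := by
      rw [Real.exp_neg]; exact inv_anti₀ (by positivity) h1
    have h3 : (ε ^ 2 / 2 + 1)⁻¹ ≤ 1 - ε ^ 2 / 3 := by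
      have h4 : ε ^ 2 ≤ 1 := by nlinarith
      rw [inv_le_iff_one_le_mul₀ (by positivity)]
      nlinarith [sq_nonneg ε]
    linarith
  have hA : 0.367 / K * (ε ^ 2 / 3) ≤ aloneProb K N * (1 - Real.exp (-(ε ^ 2 / 2))) :=
    mul_le_mul hp hx (by positivity) (aloneProb_nonneg)
  -- The constant `16` suffices because `16 · 0.367 / 3 > 1`.
  calc l ≤ 16 * (K : ℝ) / ε ^ 2 * l * (0.367 / K * (ε ^ 2 / 3)) := by
        have : 16 * (K : ℝ) / ε ^ 2 * l * (0.367 / K * (ε ^ 2 / 3)) = (16 * 0.367 / 3) * l := by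
          field_simp
        rw [this]; linarith
    _ ≤ T * (0.367 / K * (ε ^ 2 / 3)) := mul_le_mul_of_nonneg_right hT (by positivity)
    _ ≤ _ := mul_le_mul_of_nonneg_left hA (Nat.cast_nonneg T)

theorem collisions_deviation_prob {K N : ℕ} [NeZero K] (ν : Fin K → Measure ℝ)
    [∀ i, IsProbabilityMeasure (ν i)] {δ₂ : ℝ} (hδ₂ : 0 < δ₂) (hδ₂1 : δ₂ ≤ 1) {T : ℕ}
    (hT0 : 0 < T) (hT : (K : ℝ) ^ 2 * Real.log (2 / δ₂) / 0.02 ≤ T) (j : Fin N)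
    {s : ℝ} (hs : s = 1 ∨ s = -1) :
    (gameLaw N ν).real {ω | T * (71 / (500 * K)) ≤
      s * (collisions T ω j - T * (1 - (1 - 1 / (K : ℝ)) ^ (N - 1)))} ≤ δ₂ / 4 := by
  have hK0 : (0 : ℝ) < K := Nat.cast_pos.2 (NeZero.pos K)
  have hT' : (0 : ℝ) < T := by exact_mod_cast hT0
  refine (measure_collisions_deviation_le ν j (by positivity) T s hs).trans ?_
  set l := Real.log (2 / δ₂) with hl
  have hel : Real.exp (-l) = δ₂ / 2 := by
    rw [Real.exp_neg, hl, Real.exp_log (by positivity), inv_div]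
  have hl0 : 0 ≤ l := Real.log_nonneg (by rw [le_div_iff₀ hδ₂]; linarith)
  -- `71/500 = 0.142` is chosen slightly above `√0.02`, so that `2 · 0.142² / 0.02 ≥ 2`, yet small
  -- enough for `estimate_eq`. The resulting tail `(δ₂/2)²` is at most `δ₂/4` because `δ₂ ≤ 1`.
  have h1 : 2 * l ≤ 2 * ((T : ℝ) * (71 / (500 * K))) ^ 2 / T := by
    have e : 2 * ((T : ℝ) * (71 / (500 * K))) ^ 2 / T = T * (2 * (71 / 500) ^ 2 / K ^ 2) := by
      field_simp
    rw [e]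
    refine le_trans ?_ (mul_le_mul_of_nonneg_right hT (by positivity))
    have : (K : ℝ) ^ 2 * l / 0.02 * (2 * (71 / 500) ^ 2 / K ^ 2) =
        (2 * (71 / 500) ^ 2 / 0.02) * l := by field_simp
    rw [this]
    norm_num
    linarith
  calc _ ≤ Real.exp (-(2 * l)) := Real.exp_le_exp.2 (neg_le_neg h1)
    _ = (δ₂ / 2) * (δ₂ / 2) := by rw [← hel, ← Real.exp_add]; ring_nf
    _ ≤ δ₂ / 4 := by nlinarith

/-- Union bound: each player fails with probability at most `2K · δ/(4K²)` for her ranking plus `2 ·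
δ₂/4` for her estimate. Over `N` players this is `Nδ/(2K) + Nδ₂/2 ≤ δ/2 + δ/2`. -/
theorem one_sub_le_goodEvent {K N : ℕ} [NeZero K] (hN : 1 ≤ N) (hNK : N < K)
    (ν : Fin K → Measure ℝ) [∀ i, IsProbabilityMeasure (ν i)]
    (hsupp : ∀ i, ∀ᵐ x ∂(ν i), x ∈ Set.Icc (0 : ℝ) 1)
    {sort : Fin N → (Fin K → ℝ) → Equiv.Perm (Fin K)} (hsort : ∀ j, IsSortingRule (sort j))
    {ε δ δ₂ : ℝ} (hε : 0 < ε) (hε1 : ε ≤ 1) (hδ : δ ∈ Set.Ioo (0 : ℝ) 1) (hδ₂ : 0 < δ₂)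
    (hNδ₂ : (N : ℝ) * δ₂ ≤ δ) {T : ℕ} (hT : learningTime K ε δ δ₂ ≤ T) :
    1 - δ ≤ (gameLaw N ν).real (goodEvent ε (mean ν) sort T) := by
  obtain ⟨hδ0, hδ1⟩ := hδ
  have hN' : (1 : ℝ) ≤ N := by exact_mod_cast hN
  have hK0 : (0 : ℝ) < K := Nat.cast_pos.2 (NeZero.pos K)
  have hK1 : (1 : ℝ) ≤ K := by exact_mod_cast NeZero.one_le
  have hNK' : (N : ℝ) ≤ K := by exact_mod_cast hNK.le
  have hδ₂1 : δ₂ ≤ 1 := by nlinarith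
  have hmax := (Nat.le_ceil _).trans (Nat.cast_le (α := ℝ).2 hT)
  have hT2 := ((le_max_right _ _).trans (le_max_left _ _)).trans hmax
  have hT3 := (le_max_right _ _).trans hmax
  have hlog1 : 0 ≤ Real.log (4 * (K : ℝ) ^ 2 / δ) :=
    Real.log_nonneg (by rw [le_div_iff₀ hδ0]; nlinarith)
  have hlog2 : 0 < Real.log (2 / δ₂) :=
    Real.log_pos (by rw [lt_div_iff₀ hδ₂]; linarith)
  have hTpos : 0 < T := by
    have : (0 : ℝ) < T := lt_of_lt_of_le (by positivity) hT3
    exact_mod_cast this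
  set P := (gameLaw N ν)
  set R : Fin N → Fin K → ℝ → Set (ℕ → Round K N) := fun j i s =>
    {ω | 0 ≤ ∑ t ∈ Finset.range T, deviation (fun x => s * (x - mean ν i)) j i (ε / 2) (ω t)}
  set C : Fin N → ℝ → Set (ℕ → Round K N) := fun j s =>
    {ω | T * (71 / (500 * K)) ≤ s * (collisions T ω j - T * (1 - (1 - 1 / (K : ℝ)) ^ (N - 1)))}
  set B : Fin N → Set (ℕ → Round K N) := fun j =>
    (⋃ i, (R j i 1 ∪ R j i (-1))) ∪ (C j 1 ∪ C j (-1))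
  have hcompl : (goodEvent ε (mean ν) sort T)ᶜ ⊆ ⋃ j, B j := by
    intro ω hω
    by_contra hcon
    refine hω fun j => ?_
    have hj : ω ∉ B j := fun h => hcon (Set.mem_iUnion.2 ⟨j, h⟩)
    simp only [B, Set.mem_union, Set.mem_iUnion, not_or, not_exists] at hj
    obtain ⟨hR, hC1, hC2⟩ := hj
    have hCs : ∀ s, ω ∉ C j s → s * (collisions T ω j -
        T * (1 - (1 - 1 / (K : ℝ)) ^ (N - 1))) < T * (71 / (500 * K)) :=
      fun s h => not_le.1 fun h' => h h'
    refine ⟨isCorrectRanking_of_sum_deviation_neg hε (hsort j) ?_,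
      estimate_eq (by omega) hN hNK hTpos ?_ ?_⟩
    · rintro i s (rfl | rfl)
      · exact not_le.1 (hR i).1
      · exact not_le.1 (hR i).2
    · have h := hCs 1 hC1
      rwa [one_mul] at h
    · have h := hCs (-1) hC2
      rwa [neg_one_mul] at h
  have hRle : ∀ j i s, (s = 1 ∨ s = -1) → P.real (R j i s) ≤ δ / (4 * (K : ℝ) ^ 2) :=
    fun j i s hs => sum_deviation_nonneg_prob hNK.le ν hsupp hε hε1 hδ0 hT2 hlog1 j i hs
  have hCle : ∀ j s, (s = 1 ∨ s = -1) → P.real (C j s) ≤ δ₂ / 4 :=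
    fun j s hs => collisions_deviation_prob ν hδ₂ hδ₂1 hTpos hT3 j hs
  have hBle : ∀ j, P.real (B j) ≤ δ / (2 * K) + δ₂ / 2 := by
    intro j
    refine (measureReal_union_le _ _).trans (add_le_add ?_ ?_)
    · refine (measureReal_iUnion_fintype_le _).trans ?_
      calc _ ≤ ∑ _i : Fin K, δ / (2 * (K : ℝ) ^ 2) := by
            refine Finset.sum_le_sum fun i _ => (measureReal_union_le _ _).trans ?_
            have e : δ / (2 * (K : ℝ) ^ 2) = δ / (4 * (K : ℝ) ^ 2) + δ / (4 * (K : ℝ) ^ 2) := by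
              field_simp; ring
            rw [e]
            exact add_le_add (hRle j i 1 (Or.inl rfl)) (hRle j i (-1) (Or.inr rfl))
        _ = δ / (2 * K) := by
            simp only [Finset.sum_const, Finset.card_univ, Fintype.card_fin, nsmul_eq_mul]
            field_simp
    · refine (measureReal_union_le _ _).trans ?_
      linarith [hCle j 1 (Or.inl rfl), hCle j (-1) (Or.inr rfl)]
  have hfail : P.real (goodEvent ε (mean ν) sort T)ᶜ ≤ δ := by
    refine (measureReal_mono hcompl).trans ((measureReal_iUnion_fintype_le _).trans ?_)
    refine (Finset.sum_le_sum fun j _ => hBle j).trans ?_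
    simp only [Finset.sum_const, Finset.card_univ, Fintype.card_fin, nsmul_eq_mul]
    have : (N : ℝ) * (δ / (2 * K)) ≤ δ / 2 := by
      rw [← mul_div_assoc, div_le_div_iff₀ (by positivity) (by norm_num)]
      nlinarith
    linarith
  have hone : 1 ≤ P.real (goodEvent ε (mean ν) sort T) +
      P.real (goodEvent ε (mean ν) sort T)ᶜ := by
    have h := measureReal_union_le (μ := P) (goodEvent ε (mean ν) sort T)
      (goodEvent ε (mean ν) sort T)ᶜ
    rwa [Set.union_compl_self, probReal_univ] at h
  linarith

/-! ### The best arms -/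

section

variable {K N : ℕ}

/-- The arms with the `N` largest means, as they are picked by `kthBest`. -/
def bestArms (N : ℕ) (μ : Fin K → ℝ) : Finset (Fin K) :=
  (Finset.univ.filter fun k : Fin K => k.val < N).image (Tuple.sort fun i => -μ i)

theorem card_bestArms (hNK : N ≤ K) (μ : Fin K → ℝ) : (bestArms N μ).card = N := by
  rw [bestArms, Finset.card_image_of_injective _ (Equiv.injective _), Fin.card_filter_val_lt,
    min_eq_right hNK]

theorem topSum_eq (N : ℕ) (μ : Fin K → ℝ) : topSum N μ = ∑ i ∈ bestArms N μ, μ i := by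
  rw [bestArms, Finset.sum_image (Equiv.injective _).injOn, Finset.sum_filter]
  rfl

theorem kthBest_antitone (μ : Fin K → ℝ) : Antitone (kthBest μ) := by
  intro k l hkl
  have h := Tuple.monotone_sort (fun i => -μ i) hkl
  simpa [kthBest] using h

theorem lt_sub_of_mem_bestArms {μ : Fin K → ℝ} {ε : ℝ}
    (hgap : ∀ k l : Fin K, k.val < N → N ≤ l.val → ε < kthBest μ k - kthBest μ l) {i i' : Fin K}
    (hi : i ∈ bestArms N μ) (hi' : i' ∉ bestArms N μ) : ε < μ i - μ i' := by
  simp only [bestArms, Finset.mem_image, Finset.mem_filter, Finset.mem_univ, true_and] at hi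
  obtain ⟨k, hk, rfl⟩ := hi
  obtain ⟨l, rfl⟩ := (Tuple.sort fun i => -μ i).surjective i'
  have hl : N ≤ l.val := by
    by_contra hcon
    exact hi' (Finset.mem_image_of_mem _ (by simpa using hcon))
  exact hgap k l hk hl

/-- A correct ranking lists all `K - N` other arms after each best arm, so best arms have positions
below `N`; there are `N` of them, so they fill these positions. -/
theorem mem_bestArms_iff {μ : Fin K → ℝ} (hNK : N ≤ K) {ε : ℝ}
    (hgap : ∀ k l : Fin K, k.val < N → N ≤ l.val → ε < kthBest μ k - kthBest μ l) {A : Equiv.Perm (Fin K)}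
    (hA : IsCorrectRanking ε μ A) (a : Fin K) : a ∈ bestArms N μ ↔ (A.symm a).val < N := by
  have hsub : ∀ a ∈ bestArms N μ, (A.symm a).val < N := by
    intro a ha
    have h : (bestArms N μ)ᶜ.image A.symm ⊆ Finset.Ioi (A.symm a) := by
      intro b hb
      obtain ⟨i', hi', rfl⟩ := Finset.mem_image.1 hb
      exact Finset.mem_Ioi.2 (hA a i'
        (lt_sub_of_mem_bestArms hgap ha (Finset.mem_compl.1 hi')))
    have hc := Finset.card_le_card h
    rw [Finset.card_image_of_injective _ (Equiv.injective _), Finset.card_compl,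
      card_bestArms hNK, Fintype.card_fin, Fin.card_Ioi] at hc
    omega
  refine ⟨hsub a, fun ha => ?_⟩
  have himg : (bestArms N μ).image A.symm = Finset.univ.filter fun k : Fin K => k.val < N := by
    refine Finset.eq_of_subset_of_card_le ?_ ?_
    · intro b hb
      obtain ⟨i, hi, rfl⟩ := Finset.mem_image.1 hb
      simpa using hsub i hi
    · rw [Finset.card_image_of_injective _ (Equiv.injective _), Fin.card_filter_val_lt,
        card_bestArms hNK, min_eq_right hNK]
  have : A.symm a ∈ (bestArms N μ).image A.symm := by rw [himg]; simpa using ha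
  obtain ⟨b, hb, hba⟩ := Finset.mem_image.1 this
  rwa [← A.symm.injective hba]

/-! ### One round of the Musical Chairs phase -/

/-- The arms sampled by players with rankings `r` and estimates `n`, when their draws are `d`. -/
def sampledFrom [NeZero K] (r : Fin N → Equiv.Perm (Fin K)) (n : Fin N → ℕ)
    (d : Fin N → (m : Fin K) → Fin (m.val + 1)) (j : Fin N) : Fin K :=
  let m : Fin K := ⟨min (n j) K - 1, by have := NeZero.pos K; omega⟩
  r j ((d j m).castLE m.isLt)

open Classical in
/-- The arms on which the players are fixed after one more round. -/
def stepFixed (φ : Fin N → Option (Fin K)) (sampled : Fin N → Fin K) (j : Fin N) :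
    Option (Fin K) :=
  if (φ j).isNone ∧ Collides (chosen φ sampled) j then none else some (chosen φ sampled j)

/-- The fixed players sit on different arms of `S`. -/
def IsSeating (S : Finset (Fin K)) (φ : Fin N → Option (Fin K)) : Prop :=
  (∀ j a, φ j = some a → a ∈ S) ∧ ∀ j j' a, φ j = some a → φ j' = some a → j = j'

theorem chosen_eq {φ : Fin N → Option (Fin K)} {sampled : Fin N → Fin K} {j : Fin N} {a : Fin K}
    (h : φ j = some a) : chosen φ sampled j = a := by
  simp [chosen, h]

theorem chosen_mem {S : Finset (Fin K)} {φ : Fin N → Option (Fin K)} {sampled : Fin N → Fin K}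
    (hφ : IsSeating S φ) (hs : ∀ j, sampled j ∈ S) (j : Fin N) : chosen φ sampled j ∈ S := by
  rcases h : φ j with _ | a
  · simpa [chosen, h] using hs j
  · rw [chosen_eq h]; exact hφ.1 j a h

/-- Two players ending on the same arm chose it in the same round. If one of them has only just
become fixed, the other one would have collided with her; otherwise both were seated there before.
-/
theorem IsSeating.stepFixed {S : Finset (Fin K)} {φ : Fin N → Option (Fin K)}
    {sampled : Fin N → Fin K} (hφ : IsSeating S φ) (hs : ∀ j, sampled j ∈ S) :
    IsSeating S (stepFixed φ sampled) := by
  have key : ∀ j a, MusicalChairs.stepFixed φ sampled j = some a → chosen φ sampled j = a ∧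
      (φ j = some a ∨ ¬ Collides (chosen φ sampled) j) := by
    intro j a h
    unfold MusicalChairs.stepFixed at h
    split_ifs at h with hc
    have ha : chosen φ sampled j = a := by simpa using h
    refine ⟨ha, ?_⟩
    rcases hj : φ j with _ | b
    · right; simpa [hj] using hc
    · left; rw [← ha, chosen_eq hj]
  refine ⟨fun j a h => ?_, fun j j' a h h' => ?_⟩
  · rw [← (key j a h).1]; exact chosen_mem hφ hs j
  · obtain ⟨h1, h2⟩ := key j a h
    obtain ⟨h1', h2'⟩ := key j' a h'
    by_contra hne
    rcases h2 with h2 | h2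
    · rcases h2' with h2' | h2'
      · exact hne (hφ.2 j j' a h2 h2')
      · exact h2' ⟨j, hne, h1.trans h1'.symm⟩
    · exact h2 ⟨j', fun e => hne e.symm, h1'.trans h1.symm⟩

theorem eq_none_of_stepFixed_eq_none {φ : Fin N → Option (Fin K)} {sampled : Fin N → Fin K}
    {j : Fin N} (h : stepFixed φ sampled j = none) : φ j = none := by
  unfold stepFixed at h
  split_ifs at h with hc
  simpa using hc.1

open Classical in
/-- At most twice as many players have a collision as there are players who are not fixed. -/
theorem card_collides_le {S : Finset (Fin K)} {φ : Fin N → Option (Fin K)}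
    (hφ : IsSeating S φ) (sampled : Fin N → Fin K) :
    (Finset.univ.filter fun j => Collides (chosen φ sampled) j).card ≤
      2 * (Finset.univ.filter fun j => φ j = none).card := by
  set arms := chosen φ sampled
  have hsub : (Finset.univ.filter fun j => Collides arms j) ⊆
      (Finset.univ.filter fun j => φ j = none) ∪
      (Finset.univ.filter fun j => Collides arms j ∧ φ j ≠ none) := by
    intro j hj
    simp only [Finset.mem_union, Finset.mem_filter, Finset.mem_univ, true_and] at hj ⊢
    by_cases h : φ j = none <;> simp [h, hj]
  have hfix : (Finset.univ.filter fun j => Collides arms j ∧ φ j ≠ none).card ≤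
      (Finset.univ.filter fun j => φ j = none).card := by
    -- A fixed player can only be hit by an unfixed one. Choosing such an intruder is injective,
    -- since she determines the arm and the arm determines the fixed player.
    have hpart : ∀ j, Collides arms j ∧ φ j ≠ none → ∃ j', φ j' = none ∧ arms j' = arms j := by
      rintro j ⟨⟨j', hne, heq⟩, hj⟩
      refine ⟨j', ?_, heq⟩
      obtain ⟨a, ha⟩ := Option.ne_none_iff_exists'.1 hj
      by_contra hj'
      obtain ⟨b, hb⟩ := Option.ne_none_iff_exists'.1 hj'
      have e1 : arms j = a := chosen_eq ha
      have e2 : arms j' = b := chosen_eq hb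
      rw [e1, e2] at heq
      subst heq
      exact hne (hφ.2 j' j b hb ha)
    choose! g hg using hpart
    refine Finset.card_le_card_of_injOn g (fun j hj => ?_) (fun j hj j' hj' hgg => ?_)
    · simpa using (hg j (by simpa using hj)).1
    · have hj : Collides arms j ∧ φ j ≠ none := by simpa using hj
      have hj' : Collides arms j' ∧ φ j' ≠ none := by simpa using hj'
      obtain ⟨a, ha⟩ := Option.ne_none_iff_exists'.1 hj.2
      obtain ⟨b, hb⟩ := Option.ne_none_iff_exists'.1 hj'.2
      have e1 : arms j = a := chosen_eq ha
      have e2 : arms j' = b := chosen_eq hb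
      have e : a = b := by
        rw [← e1, ← e2, ← (hg j hj).2, ← (hg j' hj').2, hgg]
      subst e
      exact hφ.2 j j' a ha hb
  have h := (Finset.card_le_card hsub).trans (Finset.card_union_le _ _)
  omega

open Classical in
-- Collision-free players occupy distinct arms of `S`, so the loss is the sum of the means over the
-- other arms of `S`. As `S` has as many arms as there are players, those arms are as numerous as
-- the colliding players.
theorem sum_sub_reward_le {S : Finset (Fin K)} (hS : S.card = N) {μ : Fin K → ℝ}
    (hμ : ∀ i, μ i ≤ 1) {arms : Fin N → Fin K} (harms : ∀ j, arms j ∈ S) :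
    ∑ i ∈ S, μ i - ∑ j, μ (arms j) * (1 - if Collides arms j then (1 : ℝ) else 0) ≤
      (Finset.univ.filter fun j => Collides arms j).card := by
  set F := Finset.univ.filter fun j => ¬ Collides arms j with hF
  have hinj : Set.InjOn arms F := by
    intro j hj j' _ h
    by_contra hne
    have hj : ¬ Collides arms j := by simpa [hF] using hj
    exact hj ⟨j', fun e => hne e.symm, h.symm⟩
  have hsum : ∑ j, μ (arms j) * (1 - if Collides arms j then (1 : ℝ) else 0) =
      ∑ i ∈ F.image arms, μ i := by
    rw [Finset.sum_image hinj, hF, Finset.sum_filter]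
    refine Finset.sum_congr rfl fun j _ => ?_
    split_ifs <;> simp_all
  have himg : F.image arms ⊆ S := by
    intro a ha
    obtain ⟨j, _, rfl⟩ := Finset.mem_image.1 ha
    exact harms j
  have hFc : F = (Finset.univ.filter fun j => Collides arms j)ᶜ := by ext j; simp [hF]
  have hcard : N - F.card ≤ (Finset.univ.filter fun j => Collides arms j).card := by
    rw [hFc, Finset.card_compl, Fintype.card_fin]; omega
  rw [hsum, ← Finset.sum_sdiff himg, add_sub_cancel_right]
  refine (Finset.sum_le_card_nsmul _ _ 1 fun i _ => hμ i).trans ?_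
  rw [Finset.card_sdiff_of_subset himg, Finset.card_image_of_injOn hinj, hS, nsmul_eq_mul, mul_one]
  exact_mod_cast hcard

theorem sampledFrom_mem [NeZero K] (hN : 1 ≤ N) (hNK : N < K) {S : Finset (Fin K)}
    {r : Fin N → Equiv.Perm (Fin K)} (hr : ∀ j a, a ∈ S ↔ ((r j).symm a).val < N)
    (d : Fin N → (m : Fin K) → Fin (m.val + 1)) (j : Fin N) :
    sampledFrom r (fun _ => N) d j ∈ S := by
  rw [hr j]
  simp only [sampledFrom, Equiv.symm_apply_apply, Fin.val_castLE]
  refine lt_of_lt_of_le (Fin.is_lt _) ?_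
  omega

/-- Some arm `a` of `S` is free. It suffices that `j` draws `a` and that no other player's draw is
`a`. Asking this also of the fixed players, whose draws are ignored, makes the bound independent of
how many are fixed. -/
theorem aloneProb_le_stepFixed [NeZero K] (hN : 1 ≤ N) (hNK : N < K) (ν : Fin K → Measure ℝ)
    [∀ i, IsProbabilityMeasure (ν i)] {S : Finset (Fin K)} (hS : S.card = N)
    {r : Fin N → Equiv.Perm (Fin K)} (hr : ∀ j a, a ∈ S ↔ ((r j).symm a).val < N)
    {φ : Fin N → Option (Fin K)} {j : Fin N} (hj : φ j = none) :
    aloneProb N N ≤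
      (roundLaw N ν).real {ρ | stepFixed φ (sampledFrom r (fun _ => N) ρ.2.2) j ≠ none} := by
  classical
  -- Pigeonhole: the `N - 1` players other than `j` cannot occupy all `N` arms of `S`.
  obtain ⟨a, haS, ha⟩ : ∃ a ∈ S, ∀ j', φ j' ≠ some a := by
    have hlt : ((Finset.univ.erase j).image φ).card < (S.image some).card := by
      rw [Finset.card_image_of_injective _ (Option.some_injective _), hS]
      refine lt_of_le_of_lt Finset.card_image_le ?_
      rw [Finset.card_erase_of_mem (Finset.mem_univ j), Finset.card_univ, Fintype.card_fin]
      omega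
    obtain ⟨b, hb, hb'⟩ := Finset.exists_mem_notMem_of_card_lt_card hlt
    obtain ⟨a, ha, rfl⟩ := Finset.mem_image.1 hb
    refine ⟨a, ha, fun j' h => ?_⟩
    by_cases hjj : j' = j
    · rw [hjj, hj] at h; cases h
    · exact hb' (Finset.mem_image.2 ⟨j', by simpa using hjj, h⟩)
  set m : Fin K := ⟨min N K - 1, by omega⟩ with hm
  have hmN : m.val + 1 = N := by simp only [hm]; omega
  -- The lists may order the best arms differently, so the position to hit or avoid depends on the
  -- player.
  set x : Fin N → Fin (m.val + 1) := fun j' => ⟨((r j').symm a).val, by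
    rw [hmN]; exact (hr j' a).1 haS⟩ with hx
  have hsam : ∀ (ρ : Round K N) (j' : Fin N),
      sampledFrom r (fun _ => N) ρ.2.2 j' = a ↔ ρ.2.2 j' m = x j' := by
    intro ρ j'
    have e : sampledFrom r (fun _ => N) ρ.2.2 j' = r j' ((ρ.2.2 j' m).castLE m.isLt) := rfl
    rw [e, ← Equiv.eq_symm_apply, Fin.ext_iff, Fin.ext_iff]
    rfl
  have hprob := pi_uniformOn_only_hit x j
  rw [Fintype.card_fin, show ((m.val + 1 : ℕ) : ℝ) = N from by rw [hmN]] at hprob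
  rw [aloneProb, ← hprob,
    ← (measurePreserving_draw ν m).measureReal_preimage MeasurableSet.of_discrete.nullMeasurableSet]
  refine measureReal_mono ?_
  rintro ρ ⟨h1, h2⟩
  have hja : chosen φ (sampledFrom r (fun _ => N) ρ.2.2) j = a := by
    simp only [chosen, hj, Option.getD_none]
    exact (hsam ρ j).2 h1
  have hnc : ¬ Collides (chosen φ (sampledFrom r (fun _ => N) ρ.2.2)) j := by
    rintro ⟨j', hne, heq⟩
    rw [hja] at heq
    rcases hj' : φ j' with _ | b
    · simp only [chosen, hj', Option.getD_none] at heq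
      exact h2 j' hne ((hsam ρ j').1 heq)
    · rw [chosen_eq hj'] at heq
      exact ha j' (hj'.trans (by rw [heq]))
  change stepFixed _ _ j ≠ none
  simp [stepFixed, hnc]

end

/-! ### Measurability -/

section

variable {K N : ℕ}

instance measurableSpacePerm : MeasurableSpace (Equiv.Perm (Fin K)) := ⊤

instance measurableSpaceOption : MeasurableSpace (Option (Fin K)) := ⊤

theorem measurable_learnArm (t : ℕ) :
    Measurable fun ω : ℕ → Round K N => learnArm ω t :=
  (measurable_fst.comp measurable_snd).comp (measurable_pi_apply t)

theorem measurable_empMean (T : ℕ) (j : Fin N) :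
    Measurable fun ω : ℕ → Round K N => empMean T ω j := by
  classical
  have hset : ∀ (t : ℕ) (i : Fin K), MeasurableSet
      {ω : ℕ → Round K N | learnArm ω t j = i ∧ ¬ Collides (learnArm ω t) j} := fun t i =>
    measurable_learnArm t
      (MeasurableSet.of_discrete (s := {d : Fin N → Fin K | d j = i ∧ ¬ Collides d j}))
  refine measurable_pi_lambda _ fun i => ?_
  refine Measurable.div ?_ ?_
  · refine Finset.measurable_sum _ fun t _ => Measurable.ite (hset t i) ?_ measurable_const
    exact (measurable_pi_apply i).comp (measurable_fst.comp (measurable_pi_apply t))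
  · refine measurable_from_top.comp (g := fun n : ℕ => (n : ℝ)) ?_
    exact Finset.measurable_sum _ fun t _ =>
      Measurable.ite (hset t i) measurable_const measurable_const

theorem measurable_estimate (T : ℕ) (j : Fin N) :
    Measurable fun ω : ℕ → Round K N => estimate T ω j := by
  classical
  have hc : Measurable fun ω : ℕ → Round K N => collisions T ω j := by
    refine Finset.measurable_sum _ fun t _ => Measurable.ite ?_ measurable_const measurable_const
    exact measurable_learnArm t
      (MeasurableSet.of_discrete (s := {d : Fin N → Fin K | Collides d j}))
  exact (measurable_from_top (f := fun c : ℕ => if c = T then K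
    else (round (Real.log (((T : ℝ) - c) / T) / Real.log (1 - 1 / (K : ℝ)) + 1)).toNat)).comp hc

theorem measurable_ranking {sort : Fin N → (Fin K → ℝ) → Equiv.Perm (Fin K)}
    (hsort : ∀ j, IsSortingRule (sort j)) (T : ℕ) (j : Fin N) :
    Measurable fun ω : ℕ → Round K N => ranking sort T ω j :=
  (measurable_to_countable' (hsort j).2).comp (measurable_empMean T j)

theorem measurableSet_goodEvent {sort : Fin N → (Fin K → ℝ) → Equiv.Perm (Fin K)}
    (hsort : ∀ j, IsSortingRule (sort j)) (ε : ℝ) (μ : Fin K → ℝ) (T : ℕ) :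
    MeasurableSet (goodEvent (N := N) ε μ sort T) := by
  have h : goodEvent (N := N) ε μ sort T = ⋂ j, ({ω | IsCorrectRanking ε μ (ranking sort T ω j)} ∩
      {ω | estimate T ω j = N}) := by
    ext ω; simp [goodEvent]
  rw [h]
  refine MeasurableSet.iInter fun j => MeasurableSet.inter ?_ ?_
  · exact measurable_ranking hsort T j
      (MeasurableSet.of_discrete (s := {A | IsCorrectRanking ε μ A}))
  · exact measurable_estimate T j (measurableSet_singleton N)

/-- This makes the good event part of the past of every Musical Chairs round. -/
theorem learning_congr {T : ℕ} {ω ω' : ℕ → Round K N} (h : ∀ t < T, ω t = ω' t) :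
    (∀ (sort : Fin N → (Fin K → ℝ) → Equiv.Perm (Fin K)) j,
      ranking sort T ω j = ranking sort T ω' j) ∧ ∀ j, estimate T ω j = estimate T ω' j := by
  have hl : ∀ t ∈ Finset.range T, learnArm ω t = learnArm ω' t := fun t ht => by
    funext j; simp only [learnArm, h t (Finset.mem_range.1 ht)]
  have hemp : ∀ j, empMean T ω j = empMean T ω' j := by
    intro j
    funext i
    have h1 : rewardSum T ω j i = rewardSum T ω' j i := Finset.sum_congr rfl fun t ht => by
      rw [hl t ht, h t (Finset.mem_range.1 ht)]
    have h2 : observations T ω j i = observations T ω' j i := Finset.sum_congr rfl fun t ht => by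
      rw [hl t ht]
    rw [empMean, h1, h2, empMean]
  have hcol : ∀ j, collisions T ω j = collisions T ω' j := fun j =>
    Finset.sum_congr rfl fun t ht => by rw [hl t ht]
  exact ⟨fun sort j => by rw [ranking, ranking, hemp], fun j => by rw [estimate, estimate, hcol]⟩

variable [NeZero K]

theorem measurable_sampledArm {sort : Fin N → (Fin K → ℝ) → Equiv.Perm (Fin K)}
    (hsort : ∀ j, IsSortingRule (sort j)) (T t : ℕ) :
    Measurable fun ω : ℕ → Round K N => sampledArm sort T ω t := by
  have h : Measurable fun ω : ℕ → Round K N =>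
      ((fun j => ranking sort T ω j), (fun j => estimate T ω j), (ω t).2.2) :=
    (measurable_pi_lambda _ fun j => measurable_ranking hsort T j).prodMk
      ((measurable_pi_lambda _ fun j => measurable_estimate T j).prodMk
        ((measurable_snd.comp measurable_snd).comp (measurable_pi_apply t)))
  exact (Measurable.of_discrete (f := fun x : (Fin N → Equiv.Perm (Fin K)) × (Fin N → ℕ) ×
    (Fin N → (m : Fin K) → Fin (m.val + 1)) => sampledFrom x.1 x.2.1 x.2.2)).comp h

theorem measurable_fixedArm {sort : Fin N → (Fin K → ℝ) → Equiv.Perm (Fin K)}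
    (hsort : ∀ j, IsSortingRule (sort j)) (T s : ℕ) :
    Measurable fun ω : ℕ → Round K N => fixedArm sort T ω s := by
  induction s with
  | zero => exact measurable_const
  | succ s ih =>
    exact (Measurable.of_discrete (f := fun x : (Fin N → Option (Fin K)) × (Fin N → Fin K) =>
      stepFixed x.1 x.2)).comp (ih.prodMk (measurable_sampledArm hsort T (T + s)))

theorem measurable_playedArm {sort : Fin N → (Fin K → ℝ) → Equiv.Perm (Fin K)}
    (hsort : ∀ j, IsSortingRule (sort j)) (T t : ℕ) :
    Measurable fun ω : ℕ → Round K N => playedArm sort T ω t := by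
  by_cases ht : t < T
  · have h : (fun ω : ℕ → Round K N => playedArm sort T ω t) = fun ω => learnArm ω t := by
      funext ω j; simp [playedArm, ht]
    rw [h]; exact measurable_learnArm t
  · have h : (fun ω : ℕ → Round K N => playedArm sort T ω t) =
        fun ω => chosen (fixedArm sort T ω (t - T)) (sampledArm sort T ω t) := by
      funext ω j; simp [playedArm, ht]
    rw [h]
    exact (Measurable.of_discrete (f := fun x : (Fin N → Option (Fin K)) × (Fin N → Fin K) =>
      chosen x.1 x.2)).comp
      ((measurable_fixedArm hsort T (t - T)).prodMk (measurable_sampledArm hsort T t))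

open Classical in
-- The regret of a round depends only on the arms played, and these take finitely many values.
theorem integrable_regret (ν : Fin K → Measure ℝ) [∀ i, IsProbabilityMeasure (ν i)]
    {sort : Fin N → (Fin K → ℝ) → Equiv.Perm (Fin K)} (hsort : ∀ j, IsSortingRule (sort j))
    (μ : Fin K → ℝ) (T₀ T : ℕ) (P : Measure (ℕ → Round K N)) [IsFiniteMeasure P] :
    Integrable (regret μ sort T₀ T) P := by
  refine (integrable_const _).sub (integrable_finsetSum _ fun t _ => ?_)
  exact Integrable.comp_measurable (f := fun ω : ℕ → Round K N => playedArm sort T₀ ω t)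
    (g := fun arms : Fin N → Fin K =>
      ∑ j, μ (arms j) * (1 - if Collides arms j then (1 : ℝ) else 0))
    Integrable.of_finite (measurable_playedArm hsort T₀ t)

/-! ### Dependence on the past only -/

theorem fixedArm_congr (sort : Fin N → (Fin K → ℝ) → Equiv.Perm (Fin K)) {T s : ℕ}
    {ω ω' : ℕ → Round K N} (h : ∀ t < T + s, ω t = ω' t) :
    fixedArm sort T ω s = fixedArm sort T ω' s := by
  induction s with
  | zero => rfl
  | succ s ih =>
    obtain ⟨hr, he⟩ := learning_congr (T := T) (fun t ht => h t (by omega))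
    have hsam : sampledArm sort T ω (T + s) = sampledArm sort T ω' (T + s) := by
      change sampledFrom (fun j => ranking sort T ω j) (fun j => estimate T ω j) (ω (T + s)).2.2 =
        sampledFrom (fun j => ranking sort T ω' j) (fun j => estimate T ω' j) (ω' (T + s)).2.2
      simp only [hr sort, he, h (T + s) (by omega)]
    change stepFixed (fixedArm sort T ω s) (sampledArm sort T ω (T + s)) =
      stepFixed (fixedArm sort T ω' s) (sampledArm sort T ω' (T + s))
    rw [ih fun t ht => h t (by omega), hsam]

/-- An event which depends only on the rounds before `n` is independent of round `n`. -/
theorem measure_past_inter (ν : Fin K → Measure ℝ) [∀ i, IsProbabilityMeasure (ν i)] {n : ℕ}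
    {A : Set (ℕ → Round K N)} (hA : MeasurableSet A)
    (hloc : ∀ ω ω' : ℕ → Round K N, (∀ t < n, ω t = ω' t) → ω ∈ A → ω' ∈ A)
    {D : Set (Round K N)} (hD : MeasurableSet D) :
    (gameLaw N ν).real (A ∩ {ω | ω n ∈ D}) = (gameLaw N ν).real A * (roundLaw N ν).real D := by
  classical
  -- Completing a finite past by an arbitrary constant round exhibits `A` as an event of that past;
  -- by `hloc` the filling does not matter.
  let pad : ({t // t ∈ Finset.range n} → Round K N) → ℕ → Round K N := fun x t =>
    if h : t ∈ Finset.range n then x ⟨t, h⟩ else (0, fun _ => 0, fun _ _ => 0)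
  have hpad : Measurable pad := by
    refine measurable_pi_lambda _ fun t => ?_
    by_cases h : t ∈ Finset.range n
    · simpa only [pad, h, dif_pos] using measurable_pi_apply _
    · simpa only [pad, h, dif_neg, not_false_eq_true] using measurable_const
  have hind := (iIndepFun_rounds ν (N := N) measurable_id).indepFun_finset (Finset.range n) {n}
    (by simp) (fun t => measurable_pi_apply t)
  have h := hind.measure_inter_preimage_eq_mul (pad ⁻¹' A)
    {y | y ⟨n, Finset.mem_singleton_self n⟩ ∈ D} (hpad hA) (measurable_pi_apply _ hD)
  have e1 : (fun (a : ℕ → Round K N) (i : {t // t ∈ Finset.range n}) => id (a i)) ⁻¹'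
      (pad ⁻¹' A) = A := by
    ext ω
    have hagree : ∀ t < n, ω t = pad (fun i => id (ω i)) t := by
      intro t ht
      simp [pad, ht]
    exact ⟨fun hω => hloc _ _ (fun t ht => (hagree t ht).symm) hω, fun hω => hloc _ _ hagree hω⟩
  rw [e1] at h
  have e2 : (gameLaw N ν) ((fun (a : ℕ → Round K N) (i : ({n} : Finset ℕ)) => id (a i)) ⁻¹'
      {y | y ⟨n, Finset.mem_singleton_self n⟩ ∈ D}) = roundLaw N ν D :=
    (measurePreserving_round ν n).measure_preimage hD.nullMeasurableSet
  rw [e2] at h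
  rw [measureReal_def, measureReal_def, measureReal_def, ← ENNReal.toReal_mul, ← h]
  rfl

end

/-! ### The Musical Chairs phase on the good event -/

section

variable {K N : ℕ} [NeZero K]

theorem isSeating_fixedArm (hN : 1 ≤ N) (hNK : N < K) {ε : ℝ} {μ : Fin K → ℝ}
    (hgap : ∀ k l : Fin K, k.val < N → N ≤ l.val → ε < kthBest μ k - kthBest μ l)
    {sort : Fin N → (Fin K → ℝ) → Equiv.Perm (Fin K)} {T : ℕ} {ω : ℕ → Round K N}
    (hω : ω ∈ goodEvent ε μ sort T) :
    (∀ t j, sampledArm sort T ω t j ∈ bestArms N μ) ∧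
      ∀ s, IsSeating (bestArms N μ) (fixedArm sort T ω s) := by
  have hest : (fun j => estimate T ω j) = fun _ => N := funext fun j => (hω j).2
  have hsam : ∀ t j, sampledArm sort T ω t j ∈ bestArms N μ := by
    intro t j
    change sampledFrom (fun j => ranking sort T ω j) (fun j => estimate T ω j) (ω t).2.2 j ∈ _
    rw [hest]
    exact sampledFrom_mem hN hNK (fun j a => mem_bestArms_iff hNK.le hgap (hω j).1 a) _ _
  refine ⟨hsam, fun s => ?_⟩
  induction s with
  | zero => exact ⟨fun j a h => by simp [fixedArm] at h, fun j j' a h => by simp [fixedArm] at h⟩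
  | succ s ih => exact ih.stepFixed (hsam (T + s))

/-- The good event together with player `j` being without a fixed arm after `s` rounds of the
Musical Chairs phase. -/
def unfixedEvent (ε : ℝ) (μ : Fin K → ℝ) (sort : Fin N → (Fin K → ℝ) → Equiv.Perm (Fin K))
    (T s : ℕ) (j : Fin N) : Set (ℕ → Round K N) :=
  goodEvent ε μ sort T ∩ {ω | fixedArm sort T ω s j = none}

theorem measurableSet_unfixedEvent {sort : Fin N → (Fin K → ℝ) → Equiv.Perm (Fin K)}
    (hsort : ∀ j, IsSortingRule (sort j)) (ε : ℝ) (μ : Fin K → ℝ) (T s : ℕ) (j : Fin N) :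
    MeasurableSet (unfixedEvent ε μ sort T s j) :=
  (measurableSet_goodEvent hsort ε μ T).inter
    (measurable_fixedArm hsort T s
      (MeasurableSet.of_discrete (s := {φ : Fin N → Option (Fin K) | φ j = none})))

/-- The event is split according to the finitely many values of the rankings and the seating. Each
piece depends only on rounds before `T + s`, so it is independent of the draws of round `T + s`, to
which `aloneProb_le_stepFixed` applies with rankings and seating frozen. -/
theorem unfixedEvent_succ_le (hN : 1 ≤ N) (hNK : N < K) (ν : Fin K → Measure ℝ)
    [∀ i, IsProbabilityMeasure (ν i)] {ε : ℝ} {μ : Fin K → ℝ}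
    (hgap : ∀ k l : Fin K, k.val < N → N ≤ l.val → ε < kthBest μ k - kthBest μ l)
    {sort : Fin N → (Fin K → ℝ) → Equiv.Perm (Fin K)} (hsort : ∀ j, IsSortingRule (sort j))
    (T s : ℕ) (j : Fin N) :
    (gameLaw N ν).real (unfixedEvent ε μ sort T (s + 1) j) ≤
      (1 - aloneProb N N) * (gameLaw N ν).real (unfixedEvent ε μ sort T s j) := by
  classical
  set A : (Fin N → Equiv.Perm (Fin K)) × (Fin N → Option (Fin K)) → Set (ℕ → Round K N) :=
    fun x => unfixedEvent ε μ sort T s j ∩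
      {ω | ((fun j => ranking sort T ω j), fixedArm sort T ω s) = x} with hA
  set D : (Fin N → Equiv.Perm (Fin K)) × (Fin N → Option (Fin K)) → Set (Round K N) :=
    fun x => {ρ | stepFixed x.2 (sampledFrom x.1 (fun _ => N) ρ.2.2) j ≠ none} with hD
  have hAm : ∀ x, MeasurableSet (A x) := fun x =>
    (measurableSet_unfixedEvent hsort ε μ T s j).inter
      (((measurable_pi_lambda _ fun j => measurable_ranking hsort T j).prodMk
        (measurable_fixedArm hsort T s)) (measurableSet_singleton x))
  have hDm : ∀ x, MeasurableSet (D x) := fun x =>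
    (measurable_snd.comp measurable_snd) (MeasurableSet.of_discrete
      (s := {d : Fin N → (m : Fin K) → Fin (m.val + 1) |
        stepFixed x.2 (sampledFrom x.1 (fun _ => N) d) j ≠ none}))
  have hunion : unfixedEvent ε μ sort T s j = ⋃ x, A x := by
    ext ω; simp [hA]
  have hdisj : Pairwise (Function.onFun Disjoint A) := by
    intro x y hxy
    refine Set.disjoint_left.2 fun ω hx hy => hxy ?_
    exact (show _ = x from hx.2).symm.trans hy.2
  have hstep : unfixedEvent ε μ sort T (s + 1) j ⊆ ⋃ x, (A x ∩ {ω | ω (T + s) ∈ (D x)ᶜ}) := by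
    rintro ω ⟨hω, hnone⟩
    have hest : (fun j => estimate T ω j) = fun _ => N := funext fun j => (hω j).2
    have hnone' : stepFixed (fixedArm sort T ω s) (sampledFrom (fun j => ranking sort T ω j)
        (fun j => estimate T ω j) (ω (T + s)).2.2) j = none := hnone
    rw [hest] at hnone'
    refine Set.mem_iUnion.2 ⟨((fun j => ranking sort T ω j), fixedArm sort T ω s),
      ⟨⟨hω, eq_none_of_stepFixed_eq_none hnone'⟩, rfl⟩, ?_⟩
    exact fun h => h hnone'
  have hpiece : ∀ x, (gameLaw N ν).real (A x ∩ {ω | ω (T + s) ∈ (D x)ᶜ}) ≤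
      (1 - aloneProb N N) * (gameLaw N ν).real (A x) := by
    intro x
    -- A point of the piece certifies that the frozen rankings are correct and that `j` is unfixed;
    -- for other values of `x` the one-round bound may fail, but the piece is empty.
    rcases Set.eq_empty_or_nonempty (A x) with hx | ⟨ω, ⟨hω, hj⟩, hx⟩
    · simp [hx]
    have hloc : ∀ ω ω' : ℕ → Round K N, (∀ t < T + s, ω t = ω' t) → ω ∈ A x → ω' ∈ A x := by
      rintro ω ω' h ⟨⟨h1, h2⟩, h3⟩
      obtain ⟨hr, he⟩ := learning_congr (T := T) (fun t ht => h t (by omega))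
      have hf := fixedArm_congr sort h
      refine ⟨⟨fun j => ?_, ?_⟩, ?_⟩
      · rw [← hr, ← he]; exact h1 j
      · change fixedArm sort T ω' s j = none
        rw [← hf]; exact h2
      · change ((fun j => ranking sort T ω' j), fixedArm sort T ω' s) = x
        rw [← hf, ← show _ = x from h3]
        simp only [hr]
    rw [measure_past_inter ν (hAm x) hloc (hDm x).compl, mul_comm,
      probReal_compl_eq_one_sub (hDm x)]
    refine mul_le_mul_of_nonneg_right (sub_le_sub_left ?_ 1) measureReal_nonneg
    have hx : ((fun j => ranking sort T ω j), fixedArm sort T ω s) = x := hx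
    subst hx
    exact aloneProb_le_stepFixed hN hNK ν (card_bestArms hNK.le μ)
      (fun j a => mem_bestArms_iff hNK.le hgap (hω j).1 a) hj
  calc _ ≤ (gameLaw N ν).real (⋃ x, (A x ∩ {ω | ω (T + s) ∈ (D x)ᶜ})) := measureReal_mono hstep
    _ ≤ ∑ x, (gameLaw N ν).real (A x ∩ {ω | ω (T + s) ∈ (D x)ᶜ}) :=
      measureReal_iUnion_fintype_le _
    _ ≤ ∑ x, (1 - aloneProb N N) * (gameLaw N ν).real (A x) :=
      Finset.sum_le_sum fun x _ => hpiece x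
    _ = _ := by rw [← Finset.mul_sum, hunion, measureReal_iUnion_fintype hdisj hAm]

/-- Each step loses at least the fraction `1/(eN)` of the current probability. Telescoping these
losses bounds the sum by `eN` times the initial value, with no geometric series. -/
theorem sum_unfixedEvent_le (hN : 1 ≤ N) (hNK : N < K) (ν : Fin K → Measure ℝ)
    [∀ i, IsProbabilityMeasure (ν i)] {ε : ℝ} {μ : Fin K → ℝ}
    (hgap : ∀ k l : Fin K, k.val < N → N ≤ l.val → ε < kthBest μ k - kthBest μ l)
    {sort : Fin N → (Fin K → ℝ) → Equiv.Perm (Fin K)} (hsort : ∀ j, IsSortingRule (sort j))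
    (T n : ℕ) (j : Fin N) :
    ∑ s ∈ Finset.range n, (gameLaw N ν).real (unfixedEvent ε μ sort T s j) ≤
      Real.exp 1 * N * (gameLaw N ν).real (goodEvent ε μ sort T) := by
  have hN0 : (0 : ℝ) < N := by exact_mod_cast hN
  set p := (gameLaw N ν).real (goodEvent ε μ sort T)
  set u : ℕ → ℝ := fun s => (gameLaw N ν).real (unfixedEvent ε μ sort T s j)
  have hc : Real.exp (-1) / N ≤ aloneProb N N := by
    rw [aloneProb, div_mul_eq_mul_div, one_mul]
    exact div_le_div_of_nonneg_right (exp_neg_one_le_pow (by omega)) hN0.le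
  have hstep : ∀ s, Real.exp (-1) / N * u s ≤ u s - u (s + 1) := by
    intro s
    have h := unfixedEvent_succ_le hN hNK ν hgap hsort T s j
    have h' := mul_le_mul_of_nonneg_right hc (measureReal_nonneg (μ := gameLaw N ν)
      (s := unfixedEvent ε μ sort T s j))
    change u (s + 1) ≤ (1 - aloneProb N N) * u s at h
    change Real.exp (-1) / N * u s ≤ aloneProb N N * u s at h'
    linarith
  have hsum : Real.exp (-1) / N * ∑ s ∈ Finset.range n, u s ≤ p := by
    rw [Finset.mul_sum]
    refine (Finset.sum_le_sum fun s _ => hstep s).trans ?_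
    rw [Finset.sum_range_sub']
    have h0 : u 0 ≤ p := measureReal_mono Set.inter_subset_left
    have hn : 0 ≤ u n := measureReal_nonneg
    linarith
  have he : Real.exp (-1) / N = (Real.exp 1 * N)⁻¹ := by
    rw [Real.exp_neg, mul_inv, div_eq_mul_inv]
  rw [he, inv_mul_le_iff₀ (by positivity)] at hsum
  exact hsum

open Classical in
-- A learning round costs at most `N`; later, each unfixed player costs at most `2` per round, for
-- her own collision and for that of a fixed player she may hit.
theorem regret_le (hN : 1 ≤ N) (hNK : N < K) {ε : ℝ} {μ : Fin K → ℝ}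
    (hμ0 : ∀ i, 0 ≤ μ i) (hμ1 : ∀ i, μ i ≤ 1)
    (hgap : ∀ k l : Fin K, k.val < N → N ≤ l.val → ε < kthBest μ k - kthBest μ l)
    {sort : Fin N → (Fin K → ℝ) → Equiv.Perm (Fin K)} (T₀ T : ℕ) {ω : ℕ → Round K N}
    (hω : ω ∈ goodEvent ε μ sort T₀) :
    regret μ sort T₀ T ω ≤ T₀ * N + ∑ s ∈ Finset.range T, ∑ j,
      (unfixedEvent ε μ sort T₀ s j).indicator (fun _ => (2 : ℝ)) ω := by
  obtain ⟨hsam, hseat⟩ := isSeating_fixedArm hN hNK hgap hω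
  have hS := card_bestArms hNK.le μ
  set b : ℕ → ℝ := fun t => if t < T₀ then (N : ℝ) else
    ∑ j, (unfixedEvent ε μ sort T₀ (t - T₀) j).indicator (fun _ => (2 : ℝ)) ω with hb
  have hind : ∀ s, 0 ≤ ∑ j, (unfixedEvent ε μ sort T₀ s j).indicator (fun _ => (2 : ℝ)) ω :=
    fun s => Finset.sum_nonneg fun j _ => Set.indicator_nonneg (fun _ _ => by norm_num) _
  have hround : ∀ t, topSum N μ - ∑ j, μ (playedArm sort T₀ ω t j) *
      (1 - if Collides (playedArm sort T₀ ω t) j then (1 : ℝ) else 0) ≤ b t := by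
    intro t
    rw [topSum_eq]
    by_cases ht : t < T₀
    · simp only [hb, ht, if_true]
      have h1 : ∑ i ∈ bestArms N μ, μ i ≤ N := by
        refine (Finset.sum_le_card_nsmul _ _ 1 fun i _ => hμ1 i).trans ?_
        simp [hS]
      have h2 : 0 ≤ ∑ j, μ (playedArm sort T₀ ω t j) *
          (1 - if Collides (playedArm sort T₀ ω t) j then (1 : ℝ) else 0) :=
        Finset.sum_nonneg fun j _ => mul_nonneg (hμ0 _) (by split_ifs <;> norm_num)
      linarith
    · have hp : playedArm sort T₀ ω t =
          chosen (fixedArm sort T₀ ω (t - T₀)) (sampledArm sort T₀ ω t) := by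
        funext j; simp [playedArm, ht]
      rw [hp]
      refine (sum_sub_reward_le hS hμ1 (chosen_mem (hseat (t - T₀)) (hsam t))).trans ?_
      refine (Nat.cast_le.2 (card_collides_le (hseat (t - T₀)) _)).trans ?_
      simp only [hb, ht, if_false, Finset.card_filter]
      push_cast
      rw [Finset.mul_sum]
      refine Finset.sum_le_sum fun j _ => ?_
      by_cases hj : fixedArm sort T₀ ω (t - T₀) j = none
      · have hm : ω ∈ unfixedEvent ε μ sort T₀ (t - T₀) j := ⟨hω, hj⟩
        simp [hj, hm]
      · simp only [hj, if_false, mul_zero]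
        exact Set.indicator_nonneg (fun _ _ => by norm_num) _
  have hb0 : ∀ t, 0 ≤ b t := by
    intro t
    simp only [hb]
    split_ifs
    · positivity
    · exact hind _
  calc regret μ sort T₀ T ω = ∑ t ∈ Finset.range T, (topSum N μ -
        ∑ j, μ (playedArm sort T₀ ω t j) *
          (1 - if Collides (playedArm sort T₀ ω t) j then (1 : ℝ) else 0)) := by
        rw [Finset.sum_sub_distrib]; rfl
    _ ≤ ∑ t ∈ Finset.range T, b t := Finset.sum_le_sum fun t _ => hround t
    -- Extending the horizon adds only nonnegative terms and treats `T < T₀` and `T ≥ T₀` alike.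
    _ ≤ ∑ t ∈ Finset.range (T₀ + T), b t :=
        Finset.sum_le_sum_of_subset_of_nonneg (Finset.range_mono (by omega)) fun t _ _ => hb0 t
    _ = T₀ * N + ∑ s ∈ Finset.range T, ∑ j,
          (unfixedEvent ε μ sort T₀ s j).indicator (fun _ => (2 : ℝ)) ω := by
        rw [Finset.sum_range_add]
        congr 1
        · rw [Finset.sum_congr rfl (g := fun _ => (N : ℝ))]
          · simp
          · intro t ht; simp [hb, Finset.mem_range.1 ht]
        · refine Finset.sum_congr rfl fun s _ => ?_
          simp [hb]

theorem integral_regret_cond_le (hN : 1 ≤ N) (hNK : N < K) (ν : Fin K → Measure ℝ)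
    [∀ i, IsProbabilityMeasure (ν i)] {ε : ℝ} {μ : Fin K → ℝ}
    (hμ0 : ∀ i, 0 ≤ μ i) (hμ1 : ∀ i, μ i ≤ 1)
    (hgap : ∀ k l : Fin K, k.val < N → N ≤ l.val → ε < kthBest μ k - kthBest μ l)
    {sort : Fin N → (Fin K → ℝ) → Equiv.Perm (Fin K)} (hsort : ∀ j, IsSortingRule (sort j))
    (T₀ T : ℕ) (hpos : 0 < (gameLaw N ν).real (goodEvent ε μ sort T₀)) :
    ∫ ω, regret μ sort T₀ T ω ∂(cond (gameLaw N ν) (goodEvent ε μ sort T₀)) ≤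
      T₀ * N + 2 * Real.exp 1 * (N : ℝ) ^ 2 := by
  set E := goodEvent (N := N) ε μ sort T₀
  have hE : MeasurableSet E := measurableSet_goodEvent hsort ε μ T₀
  have hE0 : gameLaw N ν E ≠ 0 := fun h => by simp [measureReal_def, h] at hpos
  have hprob : IsProbabilityMeasure (cond (gameLaw N ν) E) := cond_isProbabilityMeasure hE0
  set Q := cond (gameLaw N ν) E with hQ
  have hU : ∀ s j, MeasurableSet (unfixedEvent ε μ sort T₀ s j) := fun s j =>
    measurableSet_unfixedEvent hsort ε μ T₀ s j
  have hint : ∀ s j, Integrable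
      ((unfixedEvent ε μ sort T₀ s j).indicator (fun _ => (2 : ℝ))) Q := fun s j =>
    (integrable_const _).indicator (hU s j)
  have hint' : Integrable (fun ω => ∑ s ∈ Finset.range T, ∑ j,
      (unfixedEvent ε μ sort T₀ s j).indicator (fun _ => (2 : ℝ)) ω) Q :=
    integrable_finsetSum _ fun s _ => integrable_finsetSum _ fun j _ => hint s j
  have hle : ∫ ω, regret μ sort T₀ T ω ∂Q ≤ ∫ ω, ((T₀ : ℝ) * N + ∑ s ∈ Finset.range T, ∑ j,
      (unfixedEvent ε μ sort T₀ s j).indicator (fun _ => (2 : ℝ)) ω) ∂Q := by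
    refine integral_mono_ae (integrable_regret ν hsort μ T₀ T Q)
      ((integrable_const _).add hint') ?_
    filter_upwards [ae_cond_mem hE] with ω hω
    exact regret_le hN hNK hμ0 hμ1 hgap T₀ T hω
  refine hle.trans ?_
  rw [integral_add (integrable_const _) hint', integral_const, probReal_univ, one_smul,
    integral_finsetSum _ fun s _ => integrable_finsetSum _ fun j _ => hint s j]
  simp_rw [integral_finsetSum _ fun j _ => hint _ j, integral_indicator_const _ (hU _ _)]
  refine add_le_add le_rfl ?_
  -- The factor `P(E)⁻¹` from conditioning cancels the `P(E)` in `sum_unfixedEvent_le`.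
  have hQU : ∀ s j, Q.real (unfixedEvent ε μ sort T₀ s j) =
      ((gameLaw N ν).real E)⁻¹ * (gameLaw N ν).real (unfixedEvent ε μ sort T₀ s j) := by
    intro s j
    rw [hQ, measureReal_def, cond_apply hE, ENNReal.toReal_mul, ENNReal.toReal_inv,
      Set.inter_eq_right.2 (show unfixedEvent ε μ sort T₀ s j ⊆ E from Set.inter_subset_left)]
    rfl
  rw [Finset.sum_comm]
  have hj : ∀ j : Fin N, ∑ s ∈ Finset.range T, Q.real (unfixedEvent ε μ sort T₀ s j) • (2 : ℝ) ≤
      2 * (Real.exp 1 * N) := by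
    intro j
    simp only [hQU, smul_eq_mul]
    rw [← Finset.sum_mul, ← Finset.mul_sum, mul_comm _ (2 : ℝ)]
    refine mul_le_mul_of_nonneg_left ?_ (by norm_num)
    rw [inv_mul_le_iff₀ hpos, mul_comm]
    exact sum_unfixedEvent_le hN hNK ν hgap hsort T₀ T j
  refine (Finset.sum_le_sum fun j _ => hj j).trans_eq ?_
  simp only [Finset.sum_const, Finset.card_univ, Fintype.card_fin, nsmul_eq_mul]
  ring

end

/-! ### Range of the means and proof of the theorem -/

theorem mean_mem_Icc {K : ℕ} {ν : Fin K → Measure ℝ} [∀ i, IsProbabilityMeasure (ν i)]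
    (hsupp : ∀ i, ∀ᵐ x ∂(ν i), x ∈ Set.Icc (0 : ℝ) 1) (i : Fin K) :
    mean ν i ∈ Set.Icc (0 : ℝ) 1 := by
  have hint : Integrable (fun x : ℝ => x) (ν i) :=
    Integrable.of_mem_Icc 0 1 aemeasurable_id (hsupp i)
  refine ⟨integral_nonneg_of_ae ((hsupp i).mono fun x hx => hx.1), ?_⟩
  have h := integral_mono_ae hint (integrable_const (1 : ℝ)) ((hsupp i).mono fun x hx => hx.2)
  simpa [mean] using h

end MusicalChairs

end

theorem theorem1 {K N : ℕ} [NeZero K] (hN : 1 ≤ N) (hNK : N < K)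
    (ν : Fin K → MeasureTheory.Measure ℝ)
    (hprob : ∀ i, MeasureTheory.IsProbabilityMeasure (ν i))
    (hsupp : ∀ i, ∀ᵐ x ∂(ν i), x ∈ Set.Icc (0 : ℝ) 1)
    (sort : Fin N → (Fin K → ℝ) → Equiv.Perm (Fin K))
    (hsort : ∀ j, MusicalChairs.IsSortingRule (sort j))
    (Δ : ℝ) (hΔ : 0 < Δ)
    (hgap : Δ = MusicalChairs.kthBest (MusicalChairs.mean ν) ⟨N - 1, by omega⟩ -
      MusicalChairs.kthBest (MusicalChairs.mean ν) ⟨N, hNK⟩)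
    (ε : ℝ) (hε : 0 < ε) (hεΔ : ε < Δ)
    (δ : ℝ) (hδ : δ ∈ Set.Ioo (0 : ℝ) 1)
    (δ₂ : ℝ) (hδ₂ : 0 < δ₂) (hNδ₂ : (N : ℝ) * δ₂ ≤ δ)
    (T₀ : ℕ) (hT₀ : T₀ = MusicalChairs.learningTime K ε δ δ₂) :
    MeasurableSet (MusicalChairs.goodEvent (N := N) ε (MusicalChairs.mean ν) sort T₀) ∧
    1 - δ ≤ (MusicalChairs.gameLaw N ν).real
      (MusicalChairs.goodEvent ε (MusicalChairs.mean ν) sort T₀) ∧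
    ∀ T : ℕ,
      MeasureTheory.Integrable (MusicalChairs.regret (MusicalChairs.mean ν) sort T₀ T)
        (MusicalChairs.gameLaw N ν) ∧
      ∫ ω, MusicalChairs.regret (MusicalChairs.mean ν) sort T₀ T ω
          ∂(ProbabilityTheory.cond (MusicalChairs.gameLaw N ν)
            (MusicalChairs.goodEvent ε (MusicalChairs.mean ν) sort T₀)) ≤
        (T₀ : ℝ) * N + 2 * Real.exp 2 * (N : ℝ) ^ 2 := by
  have hmean := MusicalChairs.mean_mem_Icc hsupp
  have hgap' : ∀ k l : Fin K, k.val < N → N ≤ l.val →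
      ε < MusicalChairs.kthBest (MusicalChairs.mean ν) k -
        MusicalChairs.kthBest (MusicalChairs.mean ν) l := by
    intro k l hk hl
    have h1 := MusicalChairs.kthBest_antitone (MusicalChairs.mean ν)
      (show k ≤ ⟨N - 1, by omega⟩ from Fin.le_def.2 (by simp; omega))
    have h2 := MusicalChairs.kthBest_antitone (MusicalChairs.mean ν)
      (show (⟨N, hNK⟩ : Fin K) ≤ l from Fin.le_def.2 hl)
    linarith
  -- `ε < Δ`, and `Δ` is a difference of two means in `[0, 1]`.
  have hε1 : ε ≤ 1 := by
    have h1 : MusicalChairs.kthBest (MusicalChairs.mean ν) ⟨N - 1, by omega⟩ ≤ 1 := (hmean _).2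
    have h2 : 0 ≤ MusicalChairs.kthBest (MusicalChairs.mean ν) ⟨N, hNK⟩ := (hmean _).1
    linarith
  have hgood := MusicalChairs.one_sub_le_goodEvent hN hNK ν hsupp hsort hε hε1 hδ hδ₂ hNδ₂ hT₀.ge
  refine ⟨MusicalChairs.measurableSet_goodEvent hsort ε _ T₀, hgood, fun T =>
    ⟨MusicalChairs.integrable_regret ν hsort _ T₀ T _, ?_⟩⟩
  refine (MusicalChairs.integral_regret_cond_le hN hNK ν (fun i => (hmean i).1)
    (fun i => (hmean i).2) hgap' hsort T₀ T (by linarith [hδ.2])).trans ?_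
  -- The argument yields `2eN²`, which is weakened to the stated `2e²N²`.
  have he : Real.exp 1 ≤ Real.exp 2 := Real.exp_le_exp.2 (by norm_num)
  gcongr
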